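/- Let $B_1\subset\mathbb R^2$ be the open unit disk and let $u(r,\theta)=2\pi r^2(\sin\theta,-\cos\theta)$ in polar coordinates. Let $\rho_0\in L^\infty(\mathbb R^2)$ vanish almost everywhere outside $\overline{B_1}$ and have zero average on almost every circle centred at the origin, i.e. $\int_{\partial B_r}\rho_0\,dS_r=0$ for almost every $r>0$. Let $\rho$ be the bounded weak solution of $$\partial_t\rho+\operatorname{div}(u\rho)=0\ \text{ on }[0,\infty)\times B_1,\qquad \rho(0,\cdot)=\rho_0 \ \text{ on } B_1,$$ in its weakly continuous representative, i.e. $\int_{B_1}\rho(T)\varphi(T)\,dx-\int_{B_1}\rho_0\varphi(0)\,dx=\int_0^T\!\int_{B_1}\rho\,(\partial_t\varphi+u\cdot\nabla\varphi)\,dx\,dt$ for all $T\ge0$ and $\varphi\in C_c^\infty(\mathbb R\times B_1)$ (it suffices that $\rho$ is bounded on $[0,T]\times B_1$ for every $T$). Put $$\|f\|_{\dot H^{-1}}=\sup\Big\{\int_{B_1} f\,\xi\,dx:\ \xi\in H^1(B_1),\ \|\nabla\xi\|_{L^2(B_1)}\le1\Big\},\qquad \|f\|_{C^{0,\alpha}}=\|f\|_{L^\infty(B_1)}+\sup_{x\ne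 y\in B_1}\frac{|f(x)-f(y)|}{|x-y|^\alpha},$$ and let $\|f\|_{\dot W^{\alpha,1}}=\iint_{B_1\times B_1}\frac{|f(x)-f(y)|}{|x-y|^{2+\alpha}}\,dx\,dy$ for $0<\alpha<1$ and $\|f\|_{\dot W^{1,1}}=\|\nabla f\|_{L^1(B_1)}$ (weak gradient). Let $\alpha\in(0,1]$. (i) If $\rho_0\in C^{0,\alpha}(B_1)$, then $$\|\rho(t,\cdot)\|_{\dot H^{-1}}\le C_3\,t^{-\frac{\alpha}{\alpha+1}}\qquad\text{for all } t\ge C_4,$$ where the positive constants $C_3,C_4$ depend only on $\alpha$, $\|\rho_0\|_{C^{0,\alpha}}$ and $\|\rho_0\|_{L^\infty}$. (ii) If $\rho_0\in\dot W^{\alpha,1}(B_1)$, then $$\|\rho(t,\cdot)\|_{\dot H^{-1}}\le C_5\,t^{-\frac{\alpha}{\alpha+4}}\qquad\text{for all } t\ge C_6,$$ where the positive constants $C_5,C_6$ depend only on $\alpha$, $\|\rho_0\|_{\dot W^{\alpha,1}}$ and $\|\rho_0\|_{L^\infty}$. -/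

import Mathlib

open MeasureTheory Set
open scoped ContDiff

namespace RadialMixing

/-- The open unit disk of the Euclidean plane. The plane `ℝ²` is identified with `ℂ`
(Euclidean norm, Lebesgue measure, real inner product `inner ℝ`). -/
def disk : Set ℂ := Metric.ball 0 1

/-- The velocity field `u(r, θ) = 2 π r² (sin θ, - cos θ)`, where `z = r e^{iθ}`. -/
noncomputable def velocity (z : ℂ) : ℂ :=
  ⟨2 * Real.pi * ‖z‖ ^ 2 * Real.sin z.arg, -(2 * Real.pi * ‖z‖ ^ 2 * Real.cos z.arg)⟩

/-- Bounded initial data which vanish outside the closed unit disk and have zero average on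
almost every circle centred at the origin. -/
structure IsDatum (ρ₀ : ℂ → ℝ) : Prop where
  memLp : MemLp ρ₀ ⊤ volume
  support : ∀ᵐ z : ℂ, z ∉ Metric.closedBall (0 : ℂ) 1 → ρ₀ z = 0
  circle : ∀ᵐ r : ℝ, 0 < r → Real.circleAverage ρ₀ 0 r = 0

/-- `ρ` is a (locally in time bounded) weak solution on `[0, ∞) × disk` of
`∂ₜ ρ + div (u ρ) = 0` with `ρ(0, ·) = ρ₀`, taken in its weakly continuous representative, so
that `ρ T` is meaningful for every single time `T ≥ 0`: the weak formulation is
`∫ ρ(T) φ(T) dx - ∫ ρ₀ φ(0) dx = ∫₀ᵀ ∫ ρ (∂ₜ φ + u · ∇φ) dx dt`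
for every `T ≥ 0` and every `φ ∈ C_c^∞(ℝ × disk)`. The derivative of `φ` in the direction
`(1, u)` is `∂ₜ φ + u · ∇φ`. -/
structure IsWeakSolution (ρ₀ : ℂ → ℝ) (ρ : ℝ → ℂ → ℝ) : Prop where
  aestronglyMeasurable : AEStronglyMeasurable (fun p : ℝ × ℂ => ρ p.1 p.2)
    (volume.restrict (Ici (0 : ℝ) ×ˢ disk))
  aestronglyMeasurable_slice : ∀ t : ℝ, 0 ≤ t →
    AEStronglyMeasurable (ρ t) (volume.restrict disk)
  bounded : ∀ T : ℝ, ∃ M : ℝ, ∀ t ∈ Icc (0 : ℝ) T,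
    ∀ᵐ x ∂(volume.restrict disk), |ρ t x| ≤ M
  weak : ∀ φ : ℝ × ℂ → ℝ, ContDiff ℝ ∞ φ → HasCompactSupport φ →
    tsupport φ ⊆ univ ×ˢ disk → ∀ T : ℝ, 0 ≤ T →
      (∫ x in disk, ρ T x * φ (T, x)) - ∫ x in disk, ρ₀ x * φ (0, x) =
        ∫ t in (0 : ℝ)..T, ∫ x in disk, ρ t x * fderiv ℝ φ (t, x) (1, velocity x)

/-- `g` is the weak gradient of `f` on the open set `U`. -/
def HasWeakGradientOn (U : Set ℂ) (f : ℂ → ℝ) (g : ℂ → ℂ) : Prop :=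
  LocallyIntegrableOn f U ∧ LocallyIntegrableOn g U ∧
    ∀ φ : ℂ → ℝ, ContDiff ℝ ∞ φ → HasCompactSupport φ → tsupport φ ⊆ U → ∀ v : ℂ,
      ∫ x in U, f x * fderiv ℝ φ x v = -∫ x in U, inner ℝ (g x) v * φ x

/-- The `L^∞` norm on the unit disk. -/
noncomputable def linftyNorm (f : ℂ → ℝ) : ENNReal :=
  eLpNorm f ⊤ (volume.restrict disk)

/-- The functional mixing scale: the homogeneous negative Sobolev norm
`sup { ∫_disk f ξ : ξ ∈ H¹(disk), ‖∇ξ‖_{L²} ≤ 1 }`. The supremum is not changed by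
`ENNReal.ofReal`, because `-ξ` is admissible together with `ξ`. -/
noncomputable def hDotNegOneNorm (f : ℂ → ℝ) : ENNReal :=
  ⨆ (ξ : ℂ → ℝ) (g : ℂ → ℂ) (_ : MemLp ξ 2 (volume.restrict disk))
    (_ : HasWeakGradientOn disk ξ g) (_ : eLpNorm g 2 (volume.restrict disk) ≤ 1),
    ENNReal.ofReal (∫ x in disk, f x * ξ x)

/-- The norm of `C^{0,α}(disk)`, equal to `⊤` if the function is not in this space:
`‖f‖_{L^∞} + sup_{x ≠ y} |f x - f y| / |x - y|^α`. -/
noncomputable def holderNorm (α : ℝ) (f : ℂ → ℝ) : ENNReal :=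
  linftyNorm f + ⨆ (x ∈ disk) (y ∈ disk) (_ : x ≠ y),
    ENNReal.ofReal (|f x - f y| / ‖x - y‖ ^ α)

/-- The seminorm of the homogeneous Sobolev space `Ẇ^{α,1}(disk)` for `0 < α ≤ 1`, equal to `⊤`
if the function is not in this space. For `α < 1` it is the Gagliardo seminorm, for `α = 1` it is
the `L¹` norm of the weak gradient (which is unique up to null sets; the infimum only serves to
give the value `⊤` if there is none). -/
noncomputable def sobolevSeminorm (α : ℝ) (f : ℂ → ℝ) : ENNReal :=
  if α < 1 then
    ∫⁻ x in disk, ∫⁻ y in disk, ENNReal.ofReal (|f x - f y| / ‖x - y‖ ^ (2 + α))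
  else
    ⨅ (g : ℂ → ℂ) (_ : HasWeakGradientOn disk f g), ∫⁻ x in disk, ‖g x‖ₑ

end RadialMixing

namespace RadialMixing

open scoped ENNReal Topology
open Filter

/-! The velocity rotates the circle of radius `r` with angular speed `2πr`, clockwise, so the
solution at time `t` is the datum composed with the backward flow. A radial shift by `s` changes the
rotation angle by `2πst`. At `t = δ⁻¹`, the shifts `s = aδ` with `0 ≤ a ≤ 1` therefore run through
exactly one full turn (`flow_pushOut`), and the average of the datum over that turn vanishes.

To estimate the pairing with `ξ`, substitute a radial shift by `aδ` and then remove the shift from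
both `ξ` and the datum. What remains is a pairing with the datum rotated by `a` turns, whose mean
over `a` is zero (`enorm_integral_flow_mul_le`). The errors come from the Jacobian `1 + s/r`, from
the parts of the disk near the origin and the boundary, and from the variation of `ξ` and of the
datum over distance `δ`.

These variations are measured by the mean oscillation `osc` (`lintegral_pushOut_sub_le`). A weak
gradient controls it (`osc_le_of_hasWeakGradientOn`), which also yields the Poincaré inequality. The
outcome, `hDotNegOneNorm_le`, is a bound of order `√δ` plus the quadratic mean oscillation of the
datum at scale `2δ`. This gives the rates `t^(-min(α, 1/2))` and `t^(-α/2)`, which are at least as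
fast as the stated ones for `α ≤ 1` and `t ≥ 1`. -/

/-! ### Twists and radial shifts in polar coordinates. -/

/-- Rotation of each circle centred at the origin by an angle depending on the radius. -/
noncomputable def twist (h : ℝ → ℝ) (z : ℂ) : ℂ := z * Complex.exp (h ‖z‖ * Complex.I)

/-- Motion along the rays from the origin by the distance `s`. -/
noncomputable def pushOut (s : ℝ) (z : ℂ) : ℂ := ((1 + s / ‖z‖ : ℝ) : ℂ) * z

@[simp] lemma norm_twist (h : ℝ → ℝ) (z : ℂ) : ‖twist h z‖ = ‖z‖ := by
  simp [twist, Complex.norm_exp_ofReal_mul_I]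

lemma measurable_twist {h : ℝ → ℝ} (hh : Measurable h) : Measurable (twist h) := by
  unfold twist; fun_prop

lemma measurable_pushOut (s : ℝ) : Measurable (pushOut s) := by
  unfold pushOut; fun_prop

lemma norm_pushOut {s : ℝ} (hs : 0 ≤ s) {z : ℂ} (hz : z ≠ 0) : ‖pushOut s z‖ = ‖z‖ + s := by
  have : 0 < ‖z‖ := norm_pos_iff.2 hz
  rw [pushOut, norm_mul, Complex.norm_real, Real.norm_of_nonneg (by positivity)]
  field_simp

lemma norm_pushOut_sub_le {s : ℝ} (hs : 0 ≤ s) (z : ℂ) : ‖pushOut s z - z‖ ≤ s := by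
  have : pushOut s z - z = ((s / ‖z‖ : ℝ) : ℂ) * z := by
    simp only [pushOut]; push_cast; ring
  rw [this, norm_mul, Complex.norm_real, Real.norm_of_nonneg (by positivity)]
  by_cases hz : ‖z‖ = 0
  · simp [hz, hs]
  · field_simp; rfl

lemma polarCoord_symm_eq_exp (p : ℝ × ℝ) :
    Complex.polarCoord.symm p = p.1 * Complex.exp (p.2 * Complex.I) := by
  rw [Complex.polarCoord_symm_apply, Complex.exp_mul_I, Complex.ofReal_cos, Complex.ofReal_sin]

/-- Integration in polar coordinates as an iterated integral. -/
lemma lintegral_eq_polar {G : ℂ → ℝ≥0∞} (hG : Measurable G) :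
    ∫⁻ z, G z = ∫⁻ r in Ioi (0 : ℝ), ENNReal.ofReal r *
      ∫⁻ θ in Ioc (-Real.pi) Real.pi, G (r * Complex.exp (θ * Complex.I)) := by
  rw [← Complex.lintegral_comp_polarCoord_symm, polarCoord_target, Measure.volume_eq_prod,
    ← Measure.prod_restrict, lintegral_prod _ (by
      simp only [polarCoord_symm_eq_exp, smul_eq_mul]; fun_prop)]
  simp only [polarCoord_symm_eq_exp, smul_eq_mul]
  refine lintegral_congr fun r => ?_
  rw [lintegral_const_mul _ (by fun_prop), Measure.restrict_congr_set Ioo_ae_eq_Ioc]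

lemma setLIntegral_add_of_periodic {F : ℝ → ℝ≥0∞} {T : ℝ} (hT : 0 < T) (hF : Function.Periodic F T)
    (a c : ℝ) :
    ∫⁻ θ in Ioc a (a + T), F (θ + c) = ∫⁻ θ in Ioc a (a + T), F θ := by
  have : Fact (0 < T) := ⟨hT⟩
  have h1 := AddCircle.lintegral_preimage T a hF.lift
  have h2 := AddCircle.lintegral_preimage T a (fun x => hF.lift (x + (c : AddCircle T)))
  rw [lintegral_add_right_eq_self (fun x => hF.lift x)] at h2
  simp only [← AddCircle.coe_add, hF.lift_coe] at h1 h2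
  exact h2.trans h1.symm

/-- In polar coordinates a twist translates the angle by an amount constant on each circle, so only
measurability of `h` matters. -/
lemma measurePreserving_twist {h : ℝ → ℝ} (hh : Measurable h) :
    MeasurePreserving (twist h) volume volume := by
  refine ⟨measurable_twist hh, Measure.ext_of_lintegral _ fun G hG => ?_⟩
  rw [lintegral_map hG (measurable_twist hh),
    lintegral_eq_polar (show Measurable fun z => G (twist h z) from hG.comp (measurable_twist hh)),
    lintegral_eq_polar hG]
  refine setLIntegral_congr_fun measurableSet_Ioi fun r hr => ?_
  have hr' : 0 < r := hr
  have hper : Function.Periodic (fun θ : ℝ => G (r * Complex.exp (θ * Complex.I)))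
      (2 * Real.pi) := by
    intro θ
    simp only
    congr 2
    push_cast
    rw [add_mul, Complex.exp_add, Complex.exp_two_pi_mul_I, mul_one]
  have := setLIntegral_add_of_periodic Real.two_pi_pos hper (-Real.pi) (h r)
  rw [show -Real.pi + 2 * Real.pi = Real.pi by ring] at this
  rw [← this]
  congr 1
  refine lintegral_congr fun θ => ?_
  have hn : ‖(r : ℂ) * Complex.exp (θ * Complex.I)‖ = r := by
    simp [Complex.norm_exp_ofReal_mul_I, abs_of_pos hr']
  rw [twist, hn, mul_assoc, ← Complex.exp_add]
  push_cast
  ring_nf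

/-- The substitution `r ↦ r + s` turns the polar weight into `r + s = r (1 + s / r)`. The image
misses the closed disk of radius `s`, up to the origin. -/
lemma lintegral_pushOut {s : ℝ} (hs : 0 ≤ s) {G : ℂ → ℝ≥0∞} (hG : Measurable G) :
    ∫⁻ w, ENNReal.ofReal (1 + s / ‖w‖) * G (pushOut s w) = ∫⁻ z in {z | s < ‖z‖}, G z := by
  have hS : MeasurableSet {z : ℂ | s < ‖z‖} := measurableSet_lt measurable_const measurable_norm
  rw [← lintegral_indicator hS, lintegral_eq_polar (hG.indicator hS), lintegral_eq_polar
    (by have := measurable_pushOut s; fun_prop)]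
  have hr0 : ∀ r : ℝ, 0 < r → ∀ θ : ℝ, ‖(r : ℂ) * Complex.exp (θ * Complex.I)‖ = r := by
    intro r hr θ
    simp [Complex.norm_exp_ofReal_mul_I, abs_of_pos hr]
  set Q : ℝ → ℝ≥0∞ := fun r => ENNReal.ofReal r *
      ∫⁻ θ in Ioc (-Real.pi) Real.pi, G (r * Complex.exp (θ * Complex.I)) with hQ
  have h1 : ∀ r ∈ Ioi (0 : ℝ), (ENNReal.ofReal r * ∫⁻ θ in Ioc (-Real.pi) Real.pi,
      indicator {z | s < ‖z‖} G (r * Complex.exp (θ * Complex.I))) = (Ioi s).indicator Q r := by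
    intro r hr
    by_cases hrs : s < r <;> simp only [indicator, mem_ofPred_eq, hr0 r hr, hrs, hQ, mem_Ioi,
      if_true, if_false, lintegral_zero, mul_zero]
  have h2 : ∀ r ∈ Ioi (0 : ℝ), (ENNReal.ofReal r * ∫⁻ θ in Ioc (-Real.pi) Real.pi,
      ENNReal.ofReal (1 + s / ‖(r : ℂ) * Complex.exp (θ * Complex.I)‖) *
        G (pushOut s (r * Complex.exp (θ * Complex.I)))) = Q (r + s) := by
    intro r hr
    have hr' : 0 < r := hr
    simp only [hr0 r hr, pushOut]
    rw [lintegral_const_mul' _ _ ENNReal.ofReal_ne_top, ← mul_assoc,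
      ← ENNReal.ofReal_mul hr'.le, hQ]
    have e1 : r * (1 + s / r) = r + s := by field_simp
    simp only [← mul_assoc, ← Complex.ofReal_mul]
    rw [e1, mul_comm (1 + s / r), e1]
  rw [setLIntegral_congr_fun measurableSet_Ioi h1, setLIntegral_congr_fun measurableSet_Ioi h2,
    ← lintegral_indicator measurableSet_Ioi, ← lintegral_indicator measurableSet_Ioi,
    ← lintegral_add_right_eq_self ((Ioi 0).indicator ((Ioi s).indicator Q)) s]
  refine lintegral_congr fun r => ?_
  simp only [indicator, mem_Ioi]
  by_cases hr : 0 < r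
  · simp [hr, add_pos_of_pos_of_nonneg hr hs]
  · simp [hr]

lemma map_pushOut {s : ℝ} (hs : 0 ≤ s) :
    (volume.withDensity fun w : ℂ => ENNReal.ofReal (1 + s / ‖w‖)).map (pushOut s) =
      volume.restrict {z | s < ‖z‖} := by
  refine Measure.ext_of_lintegral _ fun G hG => ?_
  rw [lintegral_map hG (measurable_pushOut s), lintegral_withDensity_eq_lintegral_mul _
    (by fun_prop) (show Measurable fun w => G (pushOut s w) from hG.comp (measurable_pushOut s))]
  exact lintegral_pushOut hs hG

/-- The Jacobian `1 + s / ‖w‖` is at least one. -/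
lemma lintegral_comp_pushOut_le {s : ℝ} (hs : 0 ≤ s) {G : ℂ → ℝ≥0∞} (hG : Measurable G) :
    ∫⁻ w, G (pushOut s w) ≤ ∫⁻ z, G z := by
  refine le_trans (lintegral_mono fun w => ?_)
    ((lintegral_pushOut hs hG).le.trans (setLIntegral_le_lintegral _ _))
  refine le_mul_of_one_le_left zero_le ?_
  rw [ENNReal.one_le_ofReal]
  have : 0 ≤ s / ‖w‖ := by positivity
  linarith

/-- Almost every radius is the modulus of almost every point. -/
lemma ae_norm_of_ae {P : ℝ → Prop} (hP : ∀ᵐ r : ℝ, 0 < r → P r) : ∀ᵐ z : ℂ, P ‖z‖ := by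
  obtain ⟨N, hN, hNm, hN0⟩ := exists_measurable_superset_of_null (ae_iff.1 hP)
  refine measure_mono_null (t := {z : ℂ | ‖z‖ ∈ N} ∪ {0}) ?_ ?_
  · intro z hz
    by_cases h0 : z = 0
    · exact Or.inr h0
    · exact Or.inl (hN (by simpa [h0] using hz))
  · refine measure_union_null ?_ (by simp)
    have hm : MeasurableSet {z : ℂ | ‖z‖ ∈ N} := measurable_norm hNm
    rw [← lintegral_indicator_one hm, lintegral_eq_polar (measurable_one.indicator hm)]
    rw [← lintegral_zero (μ := volume.restrict (Ioi (0 : ℝ)))]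
    refine lintegral_congr_ae ?_
    have : ∀ᵐ r : ℝ, r ∉ N := measure_eq_zero_iff_ae_notMem.1 hN0
    filter_upwards [ae_restrict_mem measurableSet_Ioi, ae_restrict_of_ae this] with r hr0 hr
    have hr0' : 0 < r := hr0
    simp [indicator, abs_of_pos hr0', hr, Complex.norm_exp_ofReal_mul_I]

/-! ### Mollification and translates of functions with a weak gradient. -/

lemma isOpen_disk : IsOpen disk := Metric.isOpen_ball

lemma measurableSet_disk : MeasurableSet disk := isOpen_disk.measurableSet

lemma convex_disk : Convex ℝ disk := convex_ball 0 1

lemma lintegral_rpow_le_rpow_lintegral {X : Type*} [MeasurableSpace X] (μ : Measure X)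
    [IsProbabilityMeasure μ] {f : X → ℝ≥0∞} (hf : Measurable f) {p : ℝ} (hp : 1 ≤ p) :
    (∫⁻ x, f x ∂μ) ^ p ≤ ∫⁻ x, f x ^ p ∂μ := by
  have h := eLpNorm'_le_eLpNorm'_of_exponent_le (μ := μ) zero_lt_one hp
    hf.aestronglyMeasurable
  simp only [eLpNorm'_eq_lintegral_enorm, ENNReal.rpow_one, enorm_eq_self, one_div, inv_one] at h
  have h2 := ENNReal.rpow_le_rpow h (zero_le_one.trans hp)
  rwa [← ENNReal.rpow_mul, inv_mul_cancel₀ (by positivity), ENNReal.rpow_one] at h2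

/-- The mollification of `u` by a bump function. -/
noncomputable def mollify (η : ContDiffBump (0 : ℂ)) (u : ℂ → ℝ) (z : ℂ) : ℝ :=
  ∫ y, u y * η.normed volume (z - y)

lemma mollify_eq_convolution (η : ContDiffBump (0 : ℂ)) (u : ℂ → ℝ) :
    mollify η u = convolution u (η.normed volume) (ContinuousLinearMap.mul ℝ ℝ) volume := by
  rfl

lemma hasFDerivAt_mollify (η : ContDiffBump (0 : ℂ)) {u : ℂ → ℝ} (hu : LocallyIntegrable u)
    (z : ℂ) : HasFDerivAt (mollify η u) (fderiv ℝ (mollify η u) z) z ∧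
      ∀ v, fderiv ℝ (mollify η u) z v = ∫ y, u y * fderiv ℝ (η.normed volume) (z - y) v := by
  have h := η.hasCompactSupport_normed.hasFDerivAt_convolution_right
    (ContinuousLinearMap.mul ℝ ℝ) hu (η.contDiff_normed (μ := volume) (n := 1)) z
  rw [← mollify_eq_convolution] at h
  refine ⟨h.differentiableAt.hasFDerivAt, fun v => ?_⟩
  rw [h.fderiv, convolution_precompR_apply _ hu (η.hasCompactSupport_normed.fderiv ℝ)
    (η.contDiff_normed (n := 1) |>.continuous_fderiv one_ne_zero)]
  rfl

lemma contDiff_mollify (η : ContDiffBump (0 : ℂ)) {u : ℂ → ℝ} (hu : LocallyIntegrable u) :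
    ContDiff ℝ 1 (mollify η u) := by
  rw [mollify_eq_convolution]
  exact η.hasCompactSupport_normed.contDiff_convolution_right _ hu η.contDiff_normed

/-- The weak formulation is tested with `y ↦ η (z - y)`, which is admissible because the ball around
`z` lies in the disk. The reflection cancels the sign from integration by parts. -/
lemma fderiv_mollify_eq {u : ℂ → ℝ} {g : ℂ → ℂ} (hw : HasWeakGradientOn disk u g)
    (hu : IntegrableOn u disk) (η : ContDiffBump (0 : ℂ)) {z : ℂ}
    (hz : Metric.closedBall z η.rOut ⊆ disk) (v : ℂ) :
    fderiv ℝ (mollify η (disk.indicator u)) z v =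
      ∫ y in disk, inner ℝ (g y) v * η.normed volume (z - y) := by
  have hu' : LocallyIntegrable (disk.indicator u) :=
    ((integrable_indicator_iff measurableSet_disk).2 hu).locallyIntegrable
  rw [(hasFDerivAt_mollify η hu' z).2 v]
  set φ : ℂ → ℝ := fun y => η.normed volume (z - y) with hφ
  have hsm : ContDiff ℝ ∞ φ := (η.contDiff_normed (n := ⊤)).comp (contDiff_const.sub contDiff_id)
  have hts : tsupport φ ⊆ Metric.closedBall z η.rOut := by
    refine closure_minimal ?_ Metric.isClosed_closedBall
    intro y hy
    have : z - y ∈ Function.support (η.normed volume) := hy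
    rw [η.support_normed_eq] at this
    rw [Metric.mem_closedBall, dist_comm, dist_eq_norm]
    exact (mem_ball_zero_iff.1 this).le
  have hcs : HasCompactSupport φ :=
    (isCompact_closedBall z η.rOut).of_isClosed_subset (isClosed_tsupport _) hts
  have hd : ∀ y, fderiv ℝ φ y v = - fderiv ℝ (η.normed volume) (z - y) v := by
    intro y
    have h1 : HasFDerivAt (η.normed volume) (fderiv ℝ (η.normed volume) (z - y)) (z - y) :=
      ((η.contDiff_normed (n := 1)).differentiable one_ne_zero _).hasFDerivAt
    have h2 : HasFDerivAt (fun y : ℂ => z - y) (-ContinuousLinearMap.id ℝ ℂ) y :=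
      (hasFDerivAt_id y).const_sub z
    have h3 : HasFDerivAt φ _ y := h1.comp y h2
    rw [h3.fderiv]
    simp
  have key := hw.2.2 φ hsm hcs (hts.trans hz) v
  rw [← neg_inj, ← key, ← integral_indicator measurableSet_disk, ← integral_neg]
  refine integral_congr_ae (ae_of_all _ fun y => ?_)
  by_cases hy : y ∈ disk <;> simp [hy, hd]

/-- The average of a function over a bump, as an extended nonnegative real. -/
noncomputable def bumpAverage (η : ContDiffBump (0 : ℂ)) (w : ℂ → ℝ≥0∞) (z : ℂ) : ℝ≥0∞ :=
  ∫⁻ y, w y * ENNReal.ofReal (η.normed volume (z - y))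

lemma measurable_bumpAverage (η : ContDiffBump (0 : ℂ)) {w : ℂ → ℝ≥0∞} (hw : Measurable w) :
    Measurable (bumpAverage η w) := by
  have := (η.continuous_normed (μ := (volume : Measure ℂ))).measurable
  unfold bumpAverage
  refine Measurable.lintegral_prod_right' (f := fun q : ℂ × ℂ =>
    w q.2 * ENNReal.ofReal (η.normed volume (q.1 - q.2))) ?_
  fun_prop

lemma lintegral_normed (η : ContDiffBump (0 : ℂ)) :
    ∫⁻ z, ENNReal.ofReal (η.normed volume z) = 1 := by
  rw [← ofReal_integral_eq_lintegral_ofReal η.integrable_normed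
    (ae_of_all _ fun x => η.nonneg_normed x), η.integral_normed, ENNReal.ofReal_one]

lemma lintegral_bumpAverage (η : ContDiffBump (0 : ℂ)) {w : ℂ → ℝ≥0∞} (hw : Measurable w) :
    ∫⁻ z, bumpAverage η w z = ∫⁻ y, w y := by
  have := (η.continuous_normed (μ := (volume : Measure ℂ))).measurable
  unfold bumpAverage
  rw [lintegral_lintegral_swap (by fun_prop)]
  refine lintegral_congr fun y => ?_
  rw [lintegral_const_mul _ (by fun_prop),
    lintegral_sub_right_eq_self (fun z => ENNReal.ofReal (η.normed volume z)),
    lintegral_normed, mul_one]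

/-- Jensen's inequality: a normalised bump is a probability density. -/
lemma bumpAverage_rpow_le (η : ContDiffBump (0 : ℂ)) {w : ℂ → ℝ≥0∞} (hw : Measurable w)
    {p : ℝ} (hp : 1 ≤ p) (z : ℂ) :
    bumpAverage η w z ^ p ≤ bumpAverage η (fun y => w y ^ p) z := by
  have hm : Measurable fun y => ENNReal.ofReal (η.normed volume (z - y)) := by
    have := (η.continuous_normed (μ := (volume : Measure ℂ))).measurable
    fun_prop
  have hprob : IsProbabilityMeasure
      ((volume : Measure ℂ).withDensity fun y => ENNReal.ofReal (η.normed volume (z - y))) := by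
    refine ⟨?_⟩
    rw [withDensity_apply _ MeasurableSet.univ, Measure.restrict_univ,
      lintegral_sub_left_eq_self (fun z => ENNReal.ofReal (η.normed volume z)), lintegral_normed]
  have h := lintegral_rpow_le_rpow_lintegral
    ((volume : Measure ℂ).withDensity fun y => ENNReal.ofReal (η.normed volume (z - y))) hw hp
  rw [lintegral_withDensity_eq_lintegral_mul _ hm hw,
    lintegral_withDensity_eq_lintegral_mul _ hm (hw.pow_const p)] at h
  simpa [bumpAverage, mul_comm] using h

/-- The mean of `bumpAverage` along a segment. -/
noncomputable def segmentAverage (η : ContDiffBump (0 : ℂ)) (w : ℂ → ℝ≥0∞) (h x : ℂ) : ℝ≥0∞ :=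
  ∫⁻ τ in Ioc (0 : ℝ) 1, bumpAverage η w (x + (τ : ℂ) * h)

lemma measurable_segmentAverage (η : ContDiffBump (0 : ℂ)) {w : ℂ → ℝ≥0∞} (hw : Measurable w)
    (h : ℂ) : Measurable (segmentAverage η w h) := by
  have := measurable_bumpAverage η hw
  unfold segmentAverage
  refine Measurable.lintegral_prod_right' (f := fun q : ℂ × ℝ =>
    bumpAverage η w (q.1 + (q.2 : ℂ) * h)) ?_
  fun_prop

lemma lintegral_segmentAverage (η : ContDiffBump (0 : ℂ)) {w : ℂ → ℝ≥0∞} (hw : Measurable w)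
    (h : ℂ) : ∫⁻ x, segmentAverage η w h x = ∫⁻ y, w y := by
  have := measurable_bumpAverage η hw
  unfold segmentAverage
  rw [lintegral_lintegral_swap (by fun_prop)]
  simp [lintegral_add_right_eq_self (bumpAverage η w), lintegral_bumpAverage η hw]

lemma segmentAverage_rpow_le (η : ContDiffBump (0 : ℂ)) {w : ℂ → ℝ≥0∞} (hw : Measurable w)
    {p : ℝ} (hp : 1 ≤ p) (h x : ℂ) :
    segmentAverage η w h x ^ p ≤ segmentAverage η (fun y => w y ^ p) h x := by
  have hprob : IsProbabilityMeasure (volume.restrict (Ioc (0 : ℝ) 1)) := ⟨by simp⟩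
  have := measurable_bumpAverage η hw
  exact (lintegral_rpow_le_rpow_lintegral _ (by fun_prop) hp).trans
    (lintegral_mono fun τ => bumpAverage_rpow_le η hw hp _)

/-- The fundamental theorem of calculus along the segment from `x` to `x + h`. The function `w` is a
measurable representative of the norm of the gradient, extended by zero. -/
lemma enorm_mollify_sub_le {u : ℂ → ℝ} {g : ℂ → ℂ} (hw : HasWeakGradientOn disk u g)
    (hu : IntegrableOn u disk) {w : ℂ → ℝ≥0∞} (hgw : ∀ᵐ y, disk.indicator (fun y => ‖g y‖ₑ) y = w y)
    (η : ContDiffBump (0 : ℂ)) {x h : ℂ} (hx : Metric.closedBall x η.rOut ⊆ disk)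
    (hxh : Metric.closedBall (x + h) η.rOut ⊆ disk) :
    ‖mollify η (disk.indicator u) (x + h) - mollify η (disk.indicator u) x‖ₑ ≤
      ‖h‖ₑ * segmentAverage η w h x := by
  have hu' : LocallyIntegrable (disk.indicator u) :=
    ((integrable_indicator_iff measurableSet_disk).2 hu).locallyIntegrable
  set a := mollify η (disk.indicator u) with ha
  have hcd : ContDiff ℝ 1 a := contDiff_mollify η hu'
  have hline : ∀ τ : ℝ, HasDerivAt (fun τ : ℝ => x + (τ : ℂ) * h) h τ := by
    intro τ
    simpa using ((Complex.ofRealCLM.hasDerivAt (x := τ)).mul_const h).const_add x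
  have hder : ∀ τ : ℝ, HasDerivAt (fun τ : ℝ => a (x + (τ : ℂ) * h))
      (fderiv ℝ a (x + (τ : ℂ) * h) h) τ := fun τ =>
    (hasFDerivAt_mollify η hu' _).1.comp_hasDerivAt τ (hline τ)
  have hcont : Continuous fun τ : ℝ => fderiv ℝ a (x + (τ : ℂ) * h) h := by
    have := hcd.continuous_fderiv one_ne_zero
    fun_prop
  have hftc := intervalIntegral.integral_eq_sub_of_hasDerivAt (a := 0) (b := 1)
    (fun τ _ => hder τ) (hcont.intervalIntegrable _ _)
  simp only [Complex.ofReal_one, one_mul, Complex.ofReal_zero, zero_mul, add_zero] at hftc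
  rw [← hftc, intervalIntegral.integral_of_le zero_le_one]
  refine (enorm_integral_le_lintegral_enorm _).trans ?_
  unfold segmentAverage
  rw [← lintegral_const_mul' _ _ enorm_ne_top]
  refine setLIntegral_mono' measurableSet_Ioc fun τ hτ => ?_
  have hball : Metric.closedBall (x + (τ : ℂ) * h) η.rOut ⊆ disk := by
    intro y hy
    -- A point near the segment is a convex combination of equally displaced points near its two
    -- ends, so convexity of the disk applies.
    have e : y = (1 - τ) • (x + (y - (x + τ * h))) + τ • (x + h + (y - (x + τ * h))) := by
      simp only [Complex.real_smul]
      push_cast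
      ring
    rw [e]
    have hn : ‖y - (x + τ * h)‖ ≤ η.rOut := by simpa [dist_eq_norm] using hy
    refine convex_disk (hx ?_) (hxh ?_) (by linarith [hτ.2]) hτ.1.le (by ring)
    · simpa [dist_eq_norm] using hn
    · simpa [dist_eq_norm] using hn
  rw [ha, fderiv_mollify_eq hw hu η hball]
  refine (enorm_integral_le_lintegral_enorm _).trans ?_
  unfold bumpAverage
  rw [← lintegral_const_mul' _ _ enorm_ne_top, ← lintegral_indicator measurableSet_disk]
  refine lintegral_mono_ae ?_
  filter_upwards [hgw] with y hy
  rw [← hy]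
  by_cases hyd : y ∈ disk
  · simp only [hyd, indicator_of_mem, enorm_mul]
    rw [← mul_assoc, Real.enorm_of_nonneg (η.nonneg_normed _)]
    gcongr
    rw [mul_comm, ← ofReal_norm, ← ofReal_norm, ← ofReal_norm,
      ← ENNReal.ofReal_mul (norm_nonneg _)]
    exact ENNReal.ofReal_le_ofReal (norm_inner_le_norm _ _)
  · simp [hyd]

/-- A sequence of bump functions at the origin with radii tending to zero. -/
noncomputable def shrinkingBump (n : ℕ) : ContDiffBump (0 : ℂ) where
  rIn := 1 / (2 * ((n : ℝ) + 1))
  rOut := 1 / ((n : ℝ) + 1)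
  rIn_pos := by positivity
  rIn_lt_rOut := by
    have : (0 : ℝ) < (n : ℝ) + 1 := by positivity
    exact one_div_lt_one_div_of_lt this (by linarith)

lemma tendsto_shrinkingBump_rOut : Tendsto (fun n => (shrinkingBump n).rOut) atTop (𝓝 0) :=
  tendsto_one_div_add_atTop_nhds_zero_nat

lemma ae_tendsto_mollify {u : ℂ → ℝ} (hu : LocallyIntegrable u) :
    ∀ᵐ x, Tendsto (fun n => mollify (shrinkingBump n) u x) atTop (𝓝 (u x)) := by
  filter_upwards [ContDiffBump.ae_convolution_tendsto_right_of_locallyIntegrable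
    (K := 2) tendsto_shrinkingBump_rOut (Eventually.of_forall fun n => by
      have : (0 : ℝ) < (n : ℝ) + 1 := by positivity
      simp only [shrinkingBump]
      field_simp
      rfl) hu] with x hx
  refine hx.congr fun n => ?_
  rw [convolution_lsmul_swap, mollify]
  simp only [smul_eq_mul, mul_comm]

lemma eventually_closedBall_subset_disk {x : ℂ} (hx : x ∈ disk) :
    ∀ᶠ n in atTop, Metric.closedBall x (shrinkingBump n).rOut ⊆ disk := by
  obtain ⟨ε, hε, hsub⟩ := Metric.isOpen_iff.1 isOpen_disk x hx
  filter_upwards [tendsto_shrinkingBump_rOut.eventually (gt_mem_nhds hε)] with n hn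
  exact (Metric.closedBall_subset_ball hn).trans hsub

/-- A function with a weak gradient changes under a translation by at most the length of the
translation times the norm of the gradient, in every `L^p`. -/
theorem lintegral_translate_sub_le {u : ℂ → ℝ} {g : ℂ → ℂ} (hw : HasWeakGradientOn disk u g)
    (hu : IntegrableOn u disk) (hg : IntegrableOn g disk) {p : ℝ} (hp : 1 ≤ p) (h : ℂ) :
    ∫⁻ x in {x | x ∈ disk ∧ x + h ∈ disk}, ‖u (x + h) - u x‖ₑ ^ p ≤
      ‖h‖ₑ ^ p * ∫⁻ x in disk, ‖g x‖ₑ ^ p := by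
  have hp0 : 0 < p := by linarith
  have hV : MeasurableSet {x | x ∈ disk ∧ x + h ∈ disk} :=
    (isOpen_disk.inter (isOpen_disk.preimage (continuous_add_const h))).measurableSet
  have hgi : AEMeasurable (disk.indicator fun y => ‖g y‖ₑ) :=
    (aemeasurable_indicator_iff measurableSet_disk).2 hg.aestronglyMeasurable.enorm
  obtain ⟨w, hwm, hgw⟩ := hgi
  have hE : ∫⁻ y, w y ^ p = ∫⁻ x in disk, ‖g x‖ₑ ^ p := by
    rw [← lintegral_indicator measurableSet_disk]
    refine lintegral_congr_ae ?_
    filter_upwards [hgw] with y hy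
    rw [← hy]
    by_cases hyd : y ∈ disk <;> simp [hyd, hp0]
  have hu' : LocallyIntegrable (disk.indicator u) :=
    ((integrable_indicator_iff measurableSet_disk).2 hu).locallyIntegrable
  have hlim := ae_tendsto_mollify hu'
  have hlim' : ∀ᵐ x, Tendsto (fun n => mollify (shrinkingBump n) (disk.indicator u) (x + h))
      atTop (𝓝 (disk.indicator u (x + h))) :=
    (measurePreserving_add_right volume h).quasiMeasurePreserving.ae hlim
  have hwp : Measurable fun y => w y ^ p := hwm.pow_const p
  -- The mollifications converge almost everywhere. Fatou's lemma carries over the bound, whose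
  -- total integral does not depend on the bump.
  calc ∫⁻ x in {x | x ∈ disk ∧ x + h ∈ disk}, ‖u (x + h) - u x‖ₑ ^ p
      ≤ ∫⁻ x in {x | x ∈ disk ∧ x + h ∈ disk}, liminf (fun n =>
          ‖h‖ₑ ^ p * segmentAverage (shrinkingBump n) (fun y => w y ^ p) h x) atTop := by
        refine lintegral_mono_ae ?_
        filter_upwards [ae_restrict_mem hV, ae_restrict_of_ae hlim, ae_restrict_of_ae hlim']
          with x hx h1 h2
        have h3 : Tendsto (fun n => ‖mollify (shrinkingBump n) (disk.indicator u) (x + h) -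
            mollify (shrinkingBump n) (disk.indicator u) x‖ₑ ^ p) atTop
            (𝓝 (‖u (x + h) - u x‖ₑ ^ p)) := by
          have := (ENNReal.continuous_rpow_const (y := p)).tendsto _ |>.comp
            (h2.sub h1).enorm
          simpa [Function.comp_def, hx.1, hx.2] using this
        rw [← h3.liminf_eq]
        refine liminf_le_liminf ?_
        filter_upwards [eventually_closedBall_subset_disk hx.1,
          eventually_closedBall_subset_disk hx.2] with n hn1 hn2
        calc _ ≤ (‖h‖ₑ * segmentAverage (shrinkingBump n) w h x) ^ p := by
              gcongr
              exact enorm_mollify_sub_le hw hu hgw _ hn1 hn2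
          _ ≤ _ := by
              rw [ENNReal.mul_rpow_of_nonneg _ _ hp0.le]
              gcongr
              exact segmentAverage_rpow_le _ hwm hp h x
    _ ≤ liminf (fun n => ∫⁻ x in {x | x ∈ disk ∧ x + h ∈ disk},
          ‖h‖ₑ ^ p * segmentAverage (shrinkingBump n) (fun y => w y ^ p) h x) atTop :=
        lintegral_liminf_le fun n => (measurable_segmentAverage _ hwp h).const_mul _
    _ ≤ liminf (fun _ : ℕ => ‖h‖ₑ ^ p * ∫⁻ x in disk, ‖g x‖ₑ ^ p) atTop := by
        refine liminf_le_liminf (Eventually.of_forall fun n => ?_)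
        refine (setLIntegral_le_lintegral _ _).trans ?_
        rw [lintegral_const_mul _ (measurable_segmentAverage _ hwp h),
          lintegral_segmentAverage _ hwp, hE]
    _ = _ := liminf_const _

/-! ### Mean oscillation, the Poincaré inequality and radial shifts. -/

/-- The pairs of points of the disk at distance less than `R`. -/
def closePairs (R : ℝ) : Set (ℂ × ℂ) := {q | q.1 ∈ disk ∧ q.2 ∈ disk ∧ ‖q.2 - q.1‖ < R}

lemma measurableSet_closePairs (R : ℝ) : MeasurableSet (closePairs R) := by
  have h1 : MeasurableSet {q : ℂ × ℂ | q.1 ∈ disk} := measurable_fst measurableSet_disk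
  have h2 : MeasurableSet {q : ℂ × ℂ | q.2 ∈ disk} := measurable_snd measurableSet_disk
  have h3 : MeasurableSet {q : ℂ × ℂ | ‖q.2 - q.1‖ < R} :=
    measurableSet_lt (by fun_prop) measurable_const
  exact h1.inter (h2.inter h3)

/-- The integrand of the mean oscillation at scale `R`. -/
noncomputable def oscIntegrand (p : ℝ) (u : ℂ → ℝ) (R : ℝ) (q : ℂ × ℂ) : ℝ≥0∞ :=
  (closePairs R).indicator (fun q => ‖u q.1 - u q.2‖ₑ ^ p) q

/-- The mean oscillation of a function on the disk at scale `R` (not normalised). -/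
noncomputable def osc (p : ℝ) (u : ℂ → ℝ) (R : ℝ) : ℝ≥0∞ :=
  ∫⁻ x, ∫⁻ y, oscIntegrand p u R (x, y)

lemma measurable_oscIntegrand (p : ℝ) {u : ℂ → ℝ} (hu : Measurable u) (R : ℝ) :
    Measurable (oscIntegrand p u R) := by
  unfold oscIntegrand
  exact Measurable.indicator (by fun_prop) (measurableSet_closePairs R)

/-- With `y = x + h`, integrate first in `x` by the translation estimate, then over `‖h‖ < R`. -/
lemma osc_le_of_hasWeakGradientOn {u : ℂ → ℝ} {g : ℂ → ℂ} (hum : Measurable u)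
    (hw : HasWeakGradientOn disk u g) (hu : IntegrableOn u disk) (hg : IntegrableOn g disk)
    {p : ℝ} (hp : 1 ≤ p) (R : ℝ) :
    osc p u R ≤ volume (Metric.ball (0 : ℂ) R) *
      (ENNReal.ofReal R ^ p * ∫⁻ x in disk, ‖g x‖ₑ ^ p) := by
  have hm := measurable_oscIntegrand p hum R
  have hp0 : 0 ≤ p := by linarith
  calc osc p u R = ∫⁻ x, ∫⁻ h, oscIntegrand p u R (x, x + h) := by
        refine lintegral_congr fun x => ?_
        rw [lintegral_add_left_eq_self (fun y => oscIntegrand p u R (x, y))]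
    _ = ∫⁻ h, ∫⁻ x, oscIntegrand p u R (x, x + h) :=
        lintegral_lintegral_swap (by fun_prop)
    _ ≤ ∫⁻ h, (Metric.ball (0 : ℂ) R).indicator
          (fun _ => ENNReal.ofReal R ^ p * ∫⁻ x in disk, ‖g x‖ₑ ^ p) h := by
        refine lintegral_mono fun h => ?_
        by_cases hh : h ∈ Metric.ball (0 : ℂ) R
        · have hhR : ‖h‖ < R := by simpa using hh
          rw [indicator_of_mem hh]
          have hV : MeasurableSet {x | x ∈ disk ∧ x + h ∈ disk} :=
            (isOpen_disk.inter (isOpen_disk.preimage (continuous_add_const h))).measurableSet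
          calc _ = ∫⁻ x in {x | x ∈ disk ∧ x + h ∈ disk}, ‖u (x + h) - u x‖ₑ ^ p := by
                rw [← lintegral_indicator hV]
                refine lintegral_congr fun x => ?_
                have hiff : (x, x + h) ∈ closePairs R ↔ x ∈ {x | x ∈ disk ∧ x + h ∈ disk} := by
                  simp [closePairs, hhR]
                by_cases hx : x ∈ {x | x ∈ disk ∧ x + h ∈ disk}
                · rw [oscIntegrand, indicator_of_mem hx, indicator_of_mem (hiff.2 hx),
                    enorm_sub_rev]
                · rw [oscIntegrand, indicator_of_notMem hx, indicator_of_notMem (mt hiff.1 hx)]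
            _ ≤ _ := lintegral_translate_sub_le hw hu hg hp h
            _ ≤ _ := by
                gcongr
                rw [← ofReal_norm]
                exact ENNReal.ofReal_le_ofReal hhR.le
        · rw [indicator_of_notMem hh]
          have hhR : ¬ ‖h‖ < R := by simpa using hh
          simp [oscIntegrand, closePairs, indicator, hhR]
    _ = _ := by
        rw [lintegral_indicator Metric.isOpen_ball.measurableSet, setLIntegral_const, mul_comm]

lemma volume_disk : volume disk = ENNReal.ofReal Real.pi := by
  rw [disk, Complex.volume_ball]
  simp [ENNReal.ofReal, NNReal.pi, Real.toNNReal_of_nonneg Real.pi_pos.le]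
  rfl

/-- The Poincaré inequality on the disk. -/
theorem exists_lintegral_sub_const_le {u : ℂ → ℝ} {g : ℂ → ℂ} (hum : Measurable u)
    (hw : HasWeakGradientOn disk u g) (hu : IntegrableOn u disk) (hg : IntegrableOn g disk) :
    ∃ c : ℝ, ∫⁻ x in disk, ‖u x - c‖ₑ ^ (2 : ℝ) ≤ 16 * ∫⁻ x in disk, ‖g x‖ₑ ^ (2 : ℝ) := by
  have hosc := osc_le_of_hasWeakGradientOn hum hw hu hg one_le_two 2
  have hm := measurable_oscIntegrand 2 hum 2
  have hπ : volume disk ≠ 0 := by simp [volume_disk, Real.pi_pos]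
  have hπ' : volume disk ≠ ⊤ := by simp [volume_disk]
  -- The constant is the value of `u` at a point where the integrated deviation is at most its
  -- average. That average is a double integral over all pairs, hence `osc` at scale `2`, the
  -- diameter of the disk.
  obtain ⟨c, hc, hle⟩ := exists_le_setLAverage (f := fun c => ∫⁻ x in disk, ‖u x - u c‖ₑ ^ (2 : ℝ))
    hπ hπ' (by
      refine Measurable.aemeasurable ?_
      refine Measurable.lintegral_prod_right' (f := fun q : ℂ × ℂ =>
        ‖u q.2 - u q.1‖ₑ ^ (2 : ℝ)) (by fun_prop))
  refine ⟨u c, hle.trans ?_⟩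
  rw [setLAverage_eq]
  refine ENNReal.div_le_of_le_mul ?_
  have hosc_eq : ∫⁻ c in disk, ∫⁻ x in disk, ‖u x - u c‖ₑ ^ (2 : ℝ) = osc 2 u 2 := by
    rw [← lintegral_indicator measurableSet_disk, osc]
    refine lintegral_congr fun x => ?_
    by_cases hx : x ∈ disk
    · rw [indicator_of_mem hx, ← lintegral_indicator measurableSet_disk]
      refine lintegral_congr fun y => ?_
      by_cases hy : y ∈ disk
      · have hxy : ‖y - x‖ < 2 := by
          have h1 : ‖x‖ < 1 := by simpa [disk] using hx
          have h2 : ‖y‖ < 1 := by simpa [disk] using hy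
          linarith [norm_sub_le y x]
        simp [oscIntegrand, closePairs, hx, hy, hxy, enorm_sub_rev]
      · simp [oscIntegrand, closePairs, hx, hy]
    · simp [oscIntegrand, closePairs, hx]
  rw [hosc_eq]
  refine hosc.trans (le_of_eq ?_)
  have e : volume (Metric.ball (0 : ℂ) 2) = 4 * volume disk := by
    rw [disk, Complex.volume_ball, Complex.volume_ball]
    norm_num
  rw [e]
  have : ENNReal.ofReal 2 ^ (2 : ℝ) = 4 := by norm_num
  rw [this]
  ring

/-- The change of a function under `pushOut` is controlled by its mean oscillation. -/
theorem lintegral_pushOut_sub_le {u : ℂ → ℝ} (hum : Measurable u) {p : ℝ} (hp : 1 ≤ p)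
    {s δ : ℝ} (hs : 0 ≤ s) (hsδ : s ≤ δ) {K : Set ℂ} (hKm : MeasurableSet K)
    (hK : ∀ x ∈ K, ‖x‖ < 1 - δ) :
    volume (Metric.ball (0 : ℂ) δ) * ∫⁻ x in K, ‖u (pushOut s x) - u x‖ₑ ^ p ≤
      2 ^ p * osc p u (2 * δ) := by
  have hm := measurable_oscIntegrand p hum (2 * δ)
  have hσ := measurable_pushOut s
  have hp0 : 0 ≤ p := by linarith
  set Q : ℂ → ℝ≥0∞ := fun z => ∫⁻ y, oscIntegrand p u (2 * δ) (z, y) with hQ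
  have hQm : Measurable Q := hm.lintegral_prod_right'
  -- Compare through an intermediate point `y` with `‖y - x‖ < δ`: both `x` and its shift are within
  -- `2 * δ` of `y`. Integrating over `y` produces the volume of the ball.
  have hpt : ∀ x ∈ K, volume (Metric.ball (0 : ℂ) δ) * ‖u (pushOut s x) - u x‖ₑ ^ p ≤
      2 ^ (p - 1) * (Q (pushOut s x) + Q x) := by
    intro x hx
    have hxn := hK x hx
    have hvol : volume (Metric.ball (0 : ℂ) δ) = volume (Metric.ball x δ) := by
      rw [Complex.volume_ball, Complex.volume_ball]
    rw [hvol, mul_comm, ← setLIntegral_const, hQ]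
    simp only
    rw [← lintegral_add_left (by fun_prop), ← lintegral_const_mul _ (by fun_prop),
      ← lintegral_indicator Metric.isOpen_ball.measurableSet]
    refine lintegral_mono fun y => ?_
    by_cases hy : y ∈ Metric.ball x δ
    swap
    · simp [hy]
    rw [indicator_of_mem hy]
    have hyx : ‖y - x‖ < δ := by simpa [dist_eq_norm] using hy
    have hσx := norm_pushOut_sub_le hs x
    have hyd : y ∈ disk := by
      have : ‖y‖ ≤ ‖y - x‖ + ‖x‖ := by simpa using norm_add_le (y - x) x
      simp only [disk, mem_ball_zero_iff]; linarith
    have hxd : x ∈ disk := by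
      simp only [disk, mem_ball_zero_iff]
      linarith
    have hσd : pushOut s x ∈ disk := by
      have : ‖pushOut s x‖ ≤ ‖pushOut s x - x‖ + ‖x‖ := by
        simpa using norm_add_le (pushOut s x - x) x
      simp only [disk, mem_ball_zero_iff]; linarith
    have h1 : ‖y - x‖ < 2 * δ := by linarith
    have h2 : ‖y - pushOut s x‖ < 2 * δ := by
      have : ‖y - pushOut s x‖ ≤ ‖y - x‖ + ‖pushOut s x - x‖ := by
        simpa using norm_sub_le (y - x) (pushOut s x - x)
      linarith
    have e1 : oscIntegrand p u (2 * δ) (pushOut s x, y) = ‖u (pushOut s x) - u y‖ₑ ^ p := by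
      simp [oscIntegrand, closePairs, hσd, hyd, h2]
    have e2 : oscIntegrand p u (2 * δ) (x, y) = ‖u x - u y‖ₑ ^ p := by
      simp [oscIntegrand, closePairs, hxd, hyd, h1]
    rw [e1, e2]
    refine le_trans ?_ (ENNReal.rpow_add_le_mul_rpow_add_rpow _ _ hp)
    gcongr
    calc ‖u (pushOut s x) - u x‖ₑ = ‖(u (pushOut s x) - u y) - (u x - u y)‖ₑ := by congr 1; ring
      _ ≤ _ := enorm_sub_le
  have hQosc : ∫⁻ z, Q z = osc p u (2 * δ) := rfl
  have hV : volume (Metric.ball (0 : ℂ) δ) ≠ ⊤ := measure_ball_lt_top.ne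
  rw [← lintegral_const_mul' _ _ hV]
  calc _ ≤ ∫⁻ x in K, 2 ^ (p - 1) * (Q (pushOut s x) + Q x) := setLIntegral_mono' hKm hpt
    _ ≤ ∫⁻ x, 2 ^ (p - 1) * (Q (pushOut s x) + Q x) := setLIntegral_le_lintegral _ _
    _ = 2 ^ (p - 1) * ((∫⁻ x, Q (pushOut s x)) + ∫⁻ x, Q x) := by
        rw [lintegral_const_mul _ (by fun_prop), lintegral_add_left (by fun_prop)]
    _ ≤ 2 ^ (p - 1) * (osc p u (2 * δ) + osc p u (2 * δ)) := by
        rw [hQosc]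
        gcongr
        -- Composition with the shift does not increase the integral of `Q`.
        exact (lintegral_comp_pushOut_le hs hQm).trans hQosc.le
    _ = _ := by
        rw [← two_mul, ← mul_assoc]
        congr 1
        nth_rw 2 [← ENNReal.rpow_one 2]
        rw [← ENNReal.rpow_add _ _ (by norm_num) (by norm_num)]
        congr 1; ring

/-! ### The flow, and the weak solution as transported datum. -/

lemma twist_twist (h₁ h₂ : ℝ → ℝ) (z : ℂ) :
    twist h₁ (twist h₂ z) = twist (fun r => h₁ r + h₂ r) z := by
  simp only [twist, norm_mul, Complex.norm_exp_ofReal_mul_I, mul_one]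
  rw [mul_assoc, ← Complex.exp_add]
  push_cast
  ring_nf

lemma twist_mem_disk {h : ℝ → ℝ} {z : ℂ} : twist h z ∈ disk ↔ z ∈ disk := by
  simp [disk]

lemma measurePreserving_twist_disk {h : ℝ → ℝ} (hh : Measurable h) :
    MeasurePreserving (twist h) (volume.restrict disk) (volume.restrict disk) := by
  have := (measurePreserving_twist hh).restrict_preimage measurableSet_disk
  rwa [show twist h ⁻¹' disk = disk from ext fun z => twist_mem_disk] at this

lemma velocity_eq (z : ℂ) : velocity z = z * ((-(2 * Real.pi * ‖z‖) : ℝ) * Complex.I) := by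
  have hre : z.re = ‖z‖ * Real.cos z.arg := (Complex.norm_mul_cos_arg z).symm
  have him : z.im = ‖z‖ * Real.sin z.arg := (Complex.norm_mul_sin_arg z).symm
  apply Complex.ext
  · simp only [velocity, Complex.mul_re, Complex.mul_im, Complex.ofReal_re, Complex.ofReal_im,
      Complex.I_re, Complex.I_im]
    rw [him]; ring
  · simp only [velocity, Complex.mul_re, Complex.mul_im, Complex.ofReal_re, Complex.ofReal_im,
      Complex.I_re, Complex.I_im]
    rw [hre]; ring

/-- The flow of the velocity field is a rotation of each circle. -/
noncomputable def flow (t : ℝ) (z : ℂ) : ℂ := twist (fun r => -(2 * Real.pi * t * r)) z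

lemma flow_flow (s t : ℝ) (z : ℂ) : flow s (flow t z) = flow (s + t) z := by
  rw [flow, flow, flow, twist_twist]
  congr 1
  ext r
  ring

lemma flow_zero (z : ℂ) : flow 0 z = z := by simp [flow, twist]

lemma norm_flow (t : ℝ) (z : ℂ) : ‖flow t z‖ = ‖z‖ := norm_twist _ _

lemma measurePreserving_flow_disk (t : ℝ) :
    MeasurePreserving (flow t) (volume.restrict disk) (volume.restrict disk) :=
  measurePreserving_twist_disk (h := fun r => -(2 * Real.pi * t * r)) (by fun_prop)

/-- Time zero suffices, because `flow_flow` reduces every other time to it. -/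
lemma hasDerivAt_flow_zero (z : ℂ) : HasDerivAt (fun t : ℝ => flow t z) (velocity z) 0 := by
  have h1 : HasDerivAt (fun t : ℝ => ((-(2 * Real.pi * t * ‖z‖) : ℝ) : ℂ) * Complex.I)
      (((-(2 * Real.pi * ‖z‖) : ℝ) : ℂ) * Complex.I) 0 := by
    have : HasDerivAt (fun t : ℝ => -(2 * Real.pi * t * ‖z‖)) (-(2 * Real.pi * ‖z‖)) 0 := by
      have := (((hasDerivAt_id (0 : ℝ)).const_mul (2 * Real.pi)).mul_const ‖z‖).neg
      simpa [Pi.neg_def] using this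
    exact this.ofReal_comp.mul_const _
  have h2 := (h1.cexp).const_mul z
  rw [velocity_eq]
  simpa [flow, twist] using h2

/-- A test function transported by the flow, with a cut-off in time. -/
noncomputable def transportedTest (χ : ContDiffBump (0 : ℝ)) (φ : ℂ → ℝ) (T : ℝ)
    (p : ℝ × ℂ) : ℝ := χ p.1 * φ (flow (T - p.1) p.2)

section transportedTest

variable (χ : ContDiffBump (0 : ℝ)) {φ : ℂ → ℝ} (T : ℝ)

lemma transportedTest_eq_zero {p : ℝ × ℂ} (hp : ‖p.2‖ ∉ norm '' tsupport φ) :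
    transportedTest χ φ T p = 0 := by
  have : φ (flow (T - p.1) p.2) = 0 := by
    by_contra hne
    exact hp ⟨_, subset_tsupport _ hne, norm_flow _ _⟩
  simp [transportedTest, this]

/-- The flow involves `‖z‖`, which is not smooth at the origin. Since `φ` vanishes near the origin
and the flow preserves moduli, the composition vanishes near the origin as well. -/
lemma contDiff_transportedTest (hφ : ContDiff ℝ ∞ φ) (hc : HasCompactSupport φ)
    (h0 : (0 : ℂ) ∉ tsupport φ) : ContDiff ℝ ∞ (transportedTest χ φ T) := by
  rw [contDiff_iff_contDiffAt]
  rintro ⟨t, x⟩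
  by_cases hx : x = 0
  · have hS : IsClosed (norm '' tsupport φ) := (hc.isCompact.image continuous_norm).isClosed
    have hmem : {p : ℝ × ℂ | ‖p.2‖ ∉ norm '' tsupport φ} ∈ 𝓝 (t, x) := by
      refine (hS.isOpen_compl.preimage (continuous_norm.comp continuous_snd)).mem_nhds ?_
      rintro ⟨y, hy, hyx⟩
      simp only [Function.comp, hx, norm_zero, norm_eq_zero] at hyx
      exact h0 (hyx ▸ hy)
    refine (contDiffAt_const (c := (0 : ℝ))).congr_of_eventuallyEq ?_
    filter_upwards [hmem] with p hp using transportedTest_eq_zero χ T hp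
  · have hn : ContDiffAt ℝ ∞ (fun p : ℝ × ℂ => ‖p.2‖) (t, x) :=
      ContDiffAt.norm ℝ contDiffAt_snd hx
    have harg : ContDiffAt ℝ ∞ (fun p : ℝ × ℂ => -(2 * Real.pi * (T - p.1) * ‖p.2‖)) (t, x) :=
      (((contDiffAt_const (c := 2 * Real.pi)).mul
        ((contDiffAt_const (c := T)).sub contDiffAt_fst)).mul hn).neg
    have harg' : ContDiffAt ℝ ∞
        (fun p : ℝ × ℂ => ((-(2 * Real.pi * (T - p.1) * ‖p.2‖) : ℝ) : ℂ)) (t, x) :=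
      Complex.ofRealCLM.contDiff.contDiffAt.comp _ harg
    have hflow : ContDiffAt ℝ ∞ (fun p : ℝ × ℂ => flow (T - p.1) p.2) (t, x) :=
      contDiffAt_snd.mul (harg'.mul contDiffAt_const).cexp
    exact (χ.contDiff.contDiffAt.comp _ contDiffAt_fst).mul (hφ.contDiffAt.comp _ hflow)

lemma tsupport_transportedTest_subset (hc : HasCompactSupport φ) :
    tsupport (transportedTest χ φ T) ⊆
      Metric.closedBall 0 χ.rOut ×ˢ (norm ⁻¹' (norm '' tsupport φ)) := by
  have hS : IsClosed (norm '' tsupport φ) := (hc.isCompact.image continuous_norm).isClosed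
  refine closure_minimal ?_ (Metric.isClosed_closedBall.prod (hS.preimage continuous_norm))
  intro p hp
  constructor
  · have : p.1 ∈ Function.support χ := left_ne_zero_of_mul hp
    rw [χ.support_eq] at this
    exact Metric.ball_subset_closedBall this
  · by_contra hne
    exact hp (transportedTest_eq_zero χ T hne)

lemma hasCompactSupport_transportedTest (hc : HasCompactSupport φ) :
    HasCompactSupport (transportedTest χ φ T) := by
  have hS : IsCompact (norm '' tsupport φ) := hc.isCompact.image continuous_norm
  have hK : IsCompact ((norm : ℂ → ℝ) ⁻¹' (norm '' tsupport φ)) := by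
    refine Metric.isCompact_of_isClosed_isBounded (hS.isClosed.preimage continuous_norm) ?_
    obtain ⟨M, hM⟩ := hS.isBounded.exists_norm_le
    refine isBounded_iff_forall_norm_le.2 ⟨M, fun x hx => ?_⟩
    simpa using hM _ hx
  exact ((isCompact_closedBall 0 χ.rOut).prod hK).of_isClosed_subset (isClosed_tsupport _)
    (tsupport_transportedTest_subset χ T hc)

/-- Where the cut-off equals one, the function is constant along the curve `h ↦ (t + h, flow h x)`,
whose velocity is `(1, velocity x)`. -/
lemma fderiv_transportedTest (hφ : ContDiff ℝ ∞ φ) (hc : HasCompactSupport φ)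
    (h0 : (0 : ℂ) ∉ tsupport φ) {t : ℝ} (ht : t ∈ Metric.ball 0 χ.rIn) (x : ℂ) :
    fderiv ℝ (transportedTest χ φ T) (t, x) (1, velocity x) = 0 := by
  have hcurve : HasDerivAt (fun h : ℝ => (t + h, flow h x)) (1, velocity x) 0 :=
    ((hasDerivAt_id (0 : ℝ)).const_add t).prodMk (hasDerivAt_flow_zero x)
  have hd : HasFDerivAt (transportedTest χ φ T)
      (fderiv ℝ (transportedTest χ φ T) (t, x)) (t + 0, flow 0 x) := by
    rw [add_zero, flow_zero]
    exact ((contDiff_transportedTest χ T hφ hc h0).differentiable (by simp) _).hasFDerivAt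
  have hcomp := hd.comp_hasDerivAt (0 : ℝ) hcurve
  refine hcomp.unique ?_
  refine (hasDerivAt_const (0 : ℝ) (φ (flow (T - t) x))).congr_of_eventuallyEq ?_
  have hmem : ∀ᶠ h : ℝ in 𝓝 0, t + h ∈ Metric.ball 0 χ.rIn := by
    have : Tendsto (fun h : ℝ => t + h) (𝓝 0) (𝓝 t) := by
      simpa using (continuous_const_add t).tendsto 0
    exact this.eventually (Metric.isOpen_ball.mem_nhds ht)
  filter_upwards [hmem] with h hh
  simp only [Function.comp, transportedTest, flow_flow,
    χ.one_of_mem_closedBall (Metric.ball_subset_closedBall hh), one_mul]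
  congr 2
  ring

end transportedTest

lemma integral_weakSolution_mul {ρ₀ : ℂ → ℝ} {ρ : ℝ → ℂ → ℝ} (hρ : IsWeakSolution ρ₀ ρ) {T : ℝ}
    (hT : 0 ≤ T) {φ : ℂ → ℝ} (hφ : ContDiff ℝ ∞ φ) (hc : HasCompactSupport φ)
    (hs : tsupport φ ⊆ disk \ {0}) :
    ∫ x in disk, ρ T x * φ x = ∫ x in disk, ρ₀ x * φ (flow T x) := by
  have h0 : (0 : ℂ) ∉ tsupport φ := fun h => (hs h).2 rfl
  -- The plateau has to contain the whole interval `[0, T]`.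
  let χ : ContDiffBump (0 : ℝ) := ⟨T + 1, T + 2, by linarith, by linarith⟩
  have hsub : tsupport (transportedTest χ φ T) ⊆ univ ×ˢ disk := by
    refine (tsupport_transportedTest_subset χ T hc).trans ?_
    rintro ⟨t, x⟩ ⟨-, y, hy, hyx⟩
    refine ⟨mem_univ _, ?_⟩
    have : y ∈ disk := (hs hy).1
    simpa [disk, ← hyx] using this
  have h := hρ.weak _ (contDiff_transportedTest χ T hφ hc h0)
    (hasCompactSupport_transportedTest χ T hc) hsub T hT
  have hχ : ∀ t ∈ Icc 0 T, t ∈ Metric.ball (0 : ℝ) χ.rIn := by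
    intro t ht
    simp only [mem_ball_zero_iff, Real.norm_of_nonneg ht.1, χ]
    linarith [ht.2]
  have hz : ∫ t in (0 : ℝ)..T, ∫ x in disk,
      ρ t x * fderiv ℝ (transportedTest χ φ T) (t, x) (1, velocity x) = 0 := by
    rw [intervalIntegral.integral_congr (g := fun _ => 0), intervalIntegral.integral_zero]
    intro t ht
    rw [uIcc_of_le hT] at ht
    simp [fderiv_transportedTest χ T hφ hc h0 (hχ t ht)]
  rw [hz, sub_eq_zero] at h
  have e1 : χ T = 1 := χ.one_of_mem_closedBall
    (Metric.ball_subset_closedBall (hχ T (right_mem_Icc.2 hT)))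
  have e2 : χ 0 = 1 := χ.one_of_mem_closedBall
    (Metric.ball_subset_closedBall (hχ 0 (left_mem_Icc.2 hT)))
  simpa [transportedTest, e1, e2, flow_zero] using h

/-- The weak solution is the initial datum transported by the flow. -/
theorem weakSolution_ae_eq {ρ₀ : ℂ → ℝ} (hρ₀ : IntegrableOn ρ₀ disk) {ρ : ℝ → ℂ → ℝ}
    (hρ : IsWeakSolution ρ₀ ρ) {T : ℝ} (hT : 0 ≤ T) :
    ∀ᵐ x ∂volume.restrict disk, ρ T x = ρ₀ (flow (-T) x) := by
  have hfin : IsFiniteMeasure (volume.restrict disk) := ⟨by simp [volume_disk]⟩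
  have hmp := measurePreserving_flow_disk (-T)
  have hint : IntegrableOn (ρ T) disk := by
    obtain ⟨M, hM⟩ := hρ.bounded T
    exact Integrable.of_bound (hρ.aestronglyMeasurable_slice T hT) M
      (by simpa using hM T (right_mem_Icc.2 hT))
  have hint' : IntegrableOn (fun x => ρ₀ (flow (-T) x)) disk := hmp.integrable_comp_of_integrable hρ₀
  have hU : IsOpen (disk \ {(0 : ℂ)}) := isOpen_disk.sdiff isClosed_singleton
  -- Test functions supported away from the origin are enough, because a point is a null set.
  have key := hU.ae_eq_zero_of_integral_contDiff_smul_eq_zero (μ := volume.restrict disk)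
    (f := fun x => ρ T x - ρ₀ (flow (-T) x))
    ((hint.sub hint').locallyIntegrable.locallyIntegrableOn _) (by
      intro φ hφ hc hs
      obtain ⟨C, hC⟩ := hc.exists_bound_of_continuous hφ.continuous
      have hφm : AEStronglyMeasurable φ (volume.restrict disk) :=
        hφ.continuous.aestronglyMeasurable
      have i1 : Integrable (fun x => ρ T x * φ x) (volume.restrict disk) :=
        hint.mul_bdd hφm (ae_of_all _ hC)
      have i2 : Integrable (fun x => ρ₀ (flow (-T) x) * φ x) (volume.restrict disk) :=
        hint'.mul_bdd hφm (ae_of_all _ hC)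
      have e : ∫ x in disk, ρ₀ (flow (-T) x) * φ x = ∫ x in disk, ρ₀ x * φ (flow T x) := by
        have hm : AEStronglyMeasurable (fun x => ρ₀ x * φ (flow T x)) (volume.restrict disk) :=
          hρ₀.aestronglyMeasurable.mul
            (hφm.comp_measurePreserving (measurePreserving_flow_disk T))
        rw [← hmp.map_eq] at hm
        have := integral_map hmp.aemeasurable hm
        rw [hmp.map_eq] at this
        rw [this]
        simp [flow_flow, flow_zero]
      simp only [smul_eq_mul, mul_comm (φ _), sub_mul]
      rw [integral_sub i1 i2, e, integral_weakSolution_mul hρ hT hφ hc hs, sub_self])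
  have hne : ∀ᵐ x : ℂ ∂volume.restrict disk, x ≠ 0 := ae_restrict_of_ae (Measure.ae_ne volume 0)
  filter_upwards [key, hne, ae_restrict_mem measurableSet_disk] with x hx hx0 hxd
  exact sub_eq_zero.1 (hx ⟨hxd, hx0⟩)

/-! ### Cauchy–Schwarz bounds and balanced functions. -/

lemma lintegral_mul_le_of_sq_le {X : Type*} [MeasurableSpace X] {μ : Measure X} {f g : X → ℝ≥0∞}
    (hf : AEMeasurable f μ) (hg : AEMeasurable g μ) {x y : ℝ} (hx : 0 ≤ x) (hy : 0 ≤ y)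
    (hfx : ∫⁻ a, f a ^ (2 : ℝ) ∂μ ≤ ENNReal.ofReal (x ^ 2))
    (hgy : ∫⁻ a, g a ^ (2 : ℝ) ∂μ ≤ ENNReal.ofReal (y ^ 2)) :
    ∫⁻ a, f a * g a ∂μ ≤ ENNReal.ofReal (x * y) := by
  have key : ∀ z : ℝ, 0 ≤ z → ENNReal.ofReal (z ^ 2) ^ (1 / (2 : ℝ)) = ENNReal.ofReal z := by
    intro z hz
    rw [ENNReal.ofReal_rpow_of_nonneg (by positivity) (by norm_num), ← Real.sqrt_eq_rpow,
      Real.sqrt_sq hz]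
  refine (ENNReal.lintegral_mul_le_Lp_mul_Lq μ Real.HolderConjugate.two_two hf hg).trans ?_
  rw [ENNReal.ofReal_mul hx, ← key x hx, ← key y hy]
  gcongr

lemma lintegral_le_of_sq_le {X : Type*} [MeasurableSpace X] {μ : Measure X} {g : X → ℝ≥0∞}
    (hg : AEMeasurable g μ) {x y : ℝ} (hx : 0 ≤ x) (hy : 0 ≤ y)
    (hμ : μ univ ≤ ENNReal.ofReal (x ^ 2))
    (hgy : ∫⁻ a, g a ^ (2 : ℝ) ∂μ ≤ ENNReal.ofReal (y ^ 2)) :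
    ∫⁻ a, g a ∂μ ≤ ENNReal.ofReal (x * y) := by
  have := lintegral_mul_le_of_sq_le (μ := μ) (f := fun _ => 1) aemeasurable_const hg hx hy
    (by simpa using hμ) hgy
  simpa using this

/-- Rotation of the plane, with the full turn as unit. -/
noncomputable def spin (a : ℝ) (z : ℂ) : ℂ := twist (fun _ => 2 * Real.pi * a) z

lemma measurable_uncurry_spin : Measurable fun q : ℝ × ℂ => spin q.1 q.2 := by
  unfold spin twist
  fun_prop

lemma measurePreserving_spin (a : ℝ) : MeasurePreserving (spin a) volume volume :=
  measurePreserving_twist measurable_const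

lemma measurePreserving_flow (t : ℝ) : MeasurePreserving (flow t) volume volume :=
  measurePreserving_twist (h := fun r => -(2 * Real.pi * t * r)) (by fun_prop)

/-- A function is balanced if its average over the circle through almost every point vanishes. -/
def IsBalanced (b : ℂ → ℝ) : Prop := ∀ᵐ z : ℂ, ∫ a in (0 : ℝ)..1, b (spin a z) = 0

lemma integrable_spin_mul {b : ℂ → ℝ} (hb : Measurable b) {M : ℝ} (hM : ∀ z, |b z| ≤ M)
    {ζ : ℂ → ℝ} (hζ : Integrable ζ) (t : ℝ) :
    Integrable (fun q : ℝ × ℂ => b (spin q.1 (flow t q.2)) * ζ q.2)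
      ((volume.restrict (Ioc (0 : ℝ) 1)).prod volume) := by
  have h1 : Integrable (fun q : ℝ × ℂ => ζ q.2) ((volume.restrict (Ioc (0 : ℝ) 1)).prod volume) :=
    hζ.comp_snd _
  refine h1.bdd_mul (c := M) ?_ (ae_of_all _ fun q => hM _)
  have h2 := (measurePreserving_flow t).measurable
  have h3 : Measurable fun q : ℝ × ℂ => spin q.1 (flow t q.2) :=
    measurable_uncurry_spin.comp (measurable_fst.prodMk (h2.comp measurable_snd))
  exact (hb.comp h3).aestronglyMeasurable

/-- By Fubini the integral over `a` comes first. It vanishes at `flow t w` for almost every `w`,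
since the flow preserves null sets. -/
lemma IsBalanced.integral_eq_zero {b : ℂ → ℝ} (hbal : IsBalanced b) (hb : Measurable b) {M : ℝ}
    (hM : ∀ z, |b z| ≤ M) {ζ : ℂ → ℝ} (hζ : Integrable ζ) (t : ℝ) :
    ∫ a in Ioc (0 : ℝ) 1, ∫ w, b (spin a (flow t w)) * ζ w = 0 := by
  rw [integral_integral_swap (integrable_spin_mul hb hM hζ t)]
  refine integral_eq_zero_of_ae ?_
  filter_upwards [(measurePreserving_flow t).quasiMeasurePreserving.ae hbal] with w hw
  rw [integral_mul_const, ← intervalIntegral.integral_of_le zero_le_one, hw, zero_mul]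
  rfl

/-- The integral over the disk of a rotated copy does not depend on `a`, so it equals its mean over
`a`, which is zero. This makes constants invisible in the pairing. -/
lemma IsBalanced.setIntegral_disk {b : ℂ → ℝ} (hbal : IsBalanced b) (hb : Measurable b) {M : ℝ}
    (hM : ∀ z, |b z| ≤ M) (t : ℝ) : ∫ x in disk, b (flow t x) = 0 := by
  have hζ : Integrable (disk.indicator fun _ => (1 : ℝ)) := by
    rw [integrable_indicator_iff measurableSet_disk]
    exact integrableOn_const (by simp [volume_disk])
  have h := hbal.integral_eq_zero hb hM hζ t
  have e : ∀ a : ℝ, ∫ w, b (spin a (flow t w)) * disk.indicator (fun _ => (1 : ℝ)) w =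
      ∫ x in disk, b (flow t x) := by
    intro a
    have h1 : ∫ w, b (spin a (flow t w)) * disk.indicator (fun _ => (1 : ℝ)) w =
        ∫ w in disk, b (spin a (flow t w)) := by
      rw [← integral_indicator measurableSet_disk]
      refine integral_congr_ae (ae_of_all _ fun w => ?_)
      by_cases hw : w ∈ disk <;> simp [hw]
    have hgen : ∀ {τ : ℂ → ℂ}, MeasurePreserving τ (volume.restrict disk) (volume.restrict disk) →
        ∫ w in disk, b (τ w) = ∫ w in disk, b w := by
      intro τ hτ
      have := integral_map (f := b) hτ.aemeasurable hb.aestronglyMeasurable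
      rw [hτ.map_eq] at this
      exact this.symm
    exact h1.trans ((hgen ((measurePreserving_twist_disk measurable_const).comp
      (measurePreserving_flow_disk t))).trans (hgen (measurePreserving_flow_disk t)).symm)
  simpa [e] using h

/-! ### The annulus and its radial shifts. -/

/-- The part of the disk on which radial shifts by at most `δ` are compared. -/
def annulus (δ : ℝ) : Set ℂ := {w | √δ < ‖w‖ ∧ ‖w‖ < 1 - δ}

lemma measurableSet_annulus (δ : ℝ) : MeasurableSet (annulus δ) :=
  (measurableSet_lt measurable_const measurable_norm).inter
    (measurableSet_lt measurable_norm measurable_const)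

lemma twist_mem_annulus {h : ℝ → ℝ} {δ : ℝ} {z : ℂ} : twist h z ∈ annulus δ ↔ z ∈ annulus δ := by
  simp [annulus]

lemma annulus_subset_disk {δ : ℝ} (hδ : 0 ≤ δ) : annulus δ ⊆ disk := by
  rintro z ⟨-, hz⟩
  simp only [disk, mem_ball_zero_iff]
  linarith

/-- The image of the annulus under `pushOut s`. -/
def shiftedAnnulus (δ s : ℝ) : Set ℂ := {w | √δ + s < ‖w‖ ∧ ‖w‖ < 1 - δ + s}

lemma measurableSet_shiftedAnnulus (δ s : ℝ) : MeasurableSet (shiftedAnnulus δ s) :=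
  (measurableSet_lt measurable_const measurable_norm).inter
    (measurableSet_lt measurable_norm measurable_const)

lemma pushOut_mem_shiftedAnnulus {δ s : ℝ} (hs : 0 ≤ s) {w : ℂ} :
    pushOut s w ∈ shiftedAnnulus δ s ↔ w ∈ annulus δ := by
  by_cases hw : w = 0
  · have : 0 ≤ √δ := Real.sqrt_nonneg δ
    simp only [hw, pushOut, shiftedAnnulus, annulus, mul_zero, norm_zero, mem_ofPred_eq]
    constructor <;> rintro ⟨h, -⟩ <;> linarith
  · simp [shiftedAnnulus, annulus, norm_pushOut hs hw]

/-- What is left out lies in a disk of radius `2√δ` and a boundary ring of width `δ`, of total area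
at most `6πδ < 25δ`. -/
lemma volume_disk_diff_shiftedAnnulus_le {δ s : ℝ} (hδ : 0 < δ) (hδ1 : δ ≤ 1) (hs : 0 ≤ s)
    (hsδ : s ≤ δ) :
    volume (disk \ shiftedAnnulus δ s) ≤ ENNReal.ofReal ((5 * √δ) ^ 2) := by
  have hsq : √δ ^ 2 = δ := Real.sq_sqrt hδ.le
  have hs1 : √δ ≤ 1 := Real.sqrt_le_one.2 hδ1
  have hs0 : 0 < √δ := Real.sqrt_pos.2 hδ
  have hsub : disk \ shiftedAnnulus δ s ⊆
      Metric.closedBall 0 (2 * √δ) ∪ (Metric.ball 0 1 \ Metric.ball 0 (1 - δ)) := by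
    rintro z ⟨hz, hzS⟩
    by_cases h : ‖z‖ < 1 - δ + s
    · left
      have : ¬ √δ + s < ‖z‖ := fun h' => hzS ⟨h', h⟩
      simp only [mem_closedBall_zero_iff]
      nlinarith
    · right
      refine ⟨hz, ?_⟩
      simp only [mem_ball_zero_iff]
      linarith
  have hball : ∀ r : ℝ, 0 ≤ r → volume (Metric.ball (0 : ℂ) r) = ENNReal.ofReal (Real.pi * r ^ 2) := by
    intro r hr
    have hπ : ((NNReal.pi : NNReal) : ℝ≥0∞) = ENNReal.ofReal Real.pi := by
      rw [← volume_disk, disk, Complex.volume_ball]; simp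
    rw [Complex.volume_ball, hπ, ← ENNReal.ofReal_pow hr, ← ENNReal.ofReal_mul (by positivity),
      mul_comm]
  have hcl : volume (Metric.closedBall (0 : ℂ) (2 * √δ)) = ENNReal.ofReal (Real.pi * (2 * √δ) ^ 2) := by
    rw [← hball _ (by positivity), Complex.volume_closedBall, Complex.volume_ball]
  refine (measure_mono hsub).trans ((measure_union_le _ _).trans ?_)
  rw [hcl, measure_sdiff (Metric.ball_subset_ball (by linarith))
    Metric.isOpen_ball.measurableSet.nullMeasurableSet measure_ball_lt_top.ne,
    hball 1 zero_le_one, hball _ (by linarith), ← ENNReal.ofReal_sub _ (by positivity),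
    ← ENNReal.ofReal_add (by positivity) (by
      nlinarith [mul_nonneg Real.pi_pos.le (mul_nonneg hδ.le (by linarith : 0 ≤ 2 - δ))])]
  refine ENNReal.ofReal_le_ofReal ?_
  have : (2 * √δ) ^ 2 = 4 * δ := by rw [mul_pow, hsq]; ring
  have h5 : (5 * √δ) ^ 2 = 25 * δ := by rw [mul_pow, hsq]; ring
  rw [this, h5]
  nlinarith [Real.pi_pos, Real.pi_lt_four, mul_nonneg Real.pi_pos.le (sq_nonneg δ), Real.pi_lt_d2]

lemma integral_shiftedAnnulus {δ s : ℝ} (hs : 0 ≤ s) {F : ℂ → ℝ} (hF : Measurable F) :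
    ∫ z in shiftedAnnulus δ s, F z = ∫ w in annulus δ, (1 + s / ‖w‖) * F (pushOut s w) := by
  have hS := measurableSet_shiftedAnnulus δ s
  have hsub : shiftedAnnulus δ s ⊆ {z | s < ‖z‖} := by
    rintro z ⟨hz, -⟩
    have : 0 ≤ √δ := Real.sqrt_nonneg δ
    simp only [mem_ofPred_eq]
    linarith
  have h0 : ∫ z in shiftedAnnulus δ s, F z =
      ∫ z in {z | s < ‖z‖}, (shiftedAnnulus δ s).indicator F z := by
    rw [integral_indicator hS, Measure.restrict_restrict hS, inter_eq_left.2 hsub]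
  rw [h0, ← map_pushOut hs, integral_map (measurable_pushOut s).aemeasurable
    (hF.indicator hS).aestronglyMeasurable,
    integral_withDensity_eq_integral_toReal_smul (by fun_prop) (ae_of_all _ fun w => by simp),
    ← integral_indicator (measurableSet_annulus δ)]
  refine integral_congr_ae (ae_of_all _ fun w => ?_)
  have hnn : 0 ≤ 1 + s / ‖w‖ := by positivity
  by_cases hw : w ∈ annulus δ
  · simp [hw, (pushOut_mem_shiftedAnnulus hs).2 hw, ENNReal.toReal_ofReal hnn]
  · simp [hw, mt (pushOut_mem_shiftedAnnulus hs).1 hw]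

/-- Shifting radially by `s` and then flowing back adds a rotation by `s * t` full turns. -/
lemma flow_pushOut {t s a : ℝ} (hs : 0 ≤ s) (hst : s * t = a) {w : ℂ} (hw : w ≠ 0) :
    flow (-t) (pushOut s w) = pushOut s (spin a (flow (-t) w)) := by
  have hn : ‖spin a (flow (-t) w)‖ = ‖w‖ := by simp [spin, flow]
  have h1 : flow (-t) (pushOut s w) =
      pushOut s w * Complex.exp ((-(2 * Real.pi * (-t) * (‖w‖ + s)) : ℝ) * Complex.I) := by
    rw [flow, twist, norm_pushOut hs hw]
  have h2 : pushOut s (spin a (flow (-t) w)) =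
      ((1 + s / ‖w‖ : ℝ) : ℂ) * spin a (flow (-t) w) := by
    rw [pushOut, hn]
  rw [h1, h2, pushOut, spin, flow, twist_twist, twist, mul_assoc, ← hst]
  push_cast
  ring_nf

/-! ### The pairing estimate. -/

section mainEstimate

variable {b ξ : ℂ → ℝ} {M B δ : ℝ}

lemma measurable_flow (t : ℝ) : Measurable (flow t) := (measurePreserving_flow t).measurable

lemma measurable_spin (a : ℝ) : Measurable (spin a) := (measurePreserving_spin a).measurable

lemma lintegral_enorm_le_of_support (hξ : Measurable ξ) (hsupp : ∀ z, z ∉ disk → ξ z = 0)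
    (h2 : ∫⁻ z, ‖ξ z‖ₑ ^ (2 : ℝ) ≤ ENNReal.ofReal (4 ^ 2)) :
    ∫⁻ z, ‖ξ z‖ₑ ≤ ENNReal.ofReal 8 := by
  have h : ∫⁻ z in disk, ‖ξ z‖ₑ ≤ ENNReal.ofReal (2 * 4) :=
    lintegral_le_of_sq_le (by fun_prop) (by norm_num) (by norm_num)
      (by
        rw [Measure.restrict_apply_univ, volume_disk]
        exact ENNReal.ofReal_le_ofReal (by linarith [Real.pi_le_four]))
      ((setLIntegral_le_lintegral _ _).trans h2)
  rw [setLIntegral_eq_of_support_subset] at h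
  · norm_num at h ⊢
    exact h
  · intro z hz
    by_contra hzd
    simp [hsupp z hzd] at hz

/-- The three terms are the errors from the Jacobian, from moving `ξ` and from moving `b`. -/
lemma enorm_mul_pushOut_sub_le (hM : ∀ z, |b z| ≤ M) (hδ : 0 < δ) {s : ℝ} (hs : 0 ≤ s)
    (hsδ : s ≤ δ) {w : ℂ} (hw : w ∈ annulus δ) :
    ‖(1 + s / ‖w‖) * (b (flow (-δ⁻¹) (pushOut s w)) * ξ (pushOut s w)) -
        b (spin (s * δ⁻¹) (flow (-δ⁻¹) w)) * ξ w‖ₑ ≤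
      ENNReal.ofReal (M * √δ) * ‖ξ (pushOut s w)‖ₑ +
        ENNReal.ofReal M * ‖ξ (pushOut s w) - ξ w‖ₑ +
        ‖b (pushOut s (spin (s * δ⁻¹) (flow (-δ⁻¹) w))) -
          b (spin (s * δ⁻¹) (flow (-δ⁻¹) w))‖ₑ * ‖ξ w‖ₑ := by
  have hM0 : 0 ≤ M := (abs_nonneg _).trans (hM 0)
  have hsq : 0 < √δ := Real.sqrt_pos.2 hδ
  have hwn : 0 < ‖w‖ := hsq.trans hw.1
  rw [flow_pushOut hs rfl (norm_pos_iff.1 hwn)]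
  set z := spin (s * δ⁻¹) (flow (-δ⁻¹) w)
  -- The inner radius `√δ` is chosen for this: it balances the Jacobian error against the area
  -- removed near the origin.
  have hsw : s / ‖w‖ ≤ √δ := by
    rw [div_le_iff₀ hwn]
    nlinarith [Real.mul_self_sqrt hδ.le, hw.1]
  have e : (1 + s / ‖w‖) * (b (pushOut s z) * ξ (pushOut s w)) - b z * ξ w =
      s / ‖w‖ * b (pushOut s z) * ξ (pushOut s w) + b (pushOut s z) * (ξ (pushOut s w) - ξ w) +
        (b (pushOut s z) - b z) * ξ w := by ring
  rw [e]
  refine (enorm_add_le _ _).trans (add_le_add ((enorm_add_le _ _).trans (add_le_add ?_ ?_)) ?_)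
  · rw [enorm_mul]
    gcongr
    rw [← ofReal_norm, Real.norm_eq_abs, abs_mul, abs_of_nonneg (by positivity : 0 ≤ s / ‖w‖),
      mul_comm]
    exact ENNReal.ofReal_le_ofReal (mul_le_mul (hM _) hsw (by positivity) hM0)
  · rw [enorm_mul]
    gcongr
    rw [← ofReal_norm]
    exact ENNReal.ofReal_le_ofReal (hM _)
  · rw [enorm_mul]

/-- The constant `44` is `20 + 8 + 16`: the region outside the shifted annulus, the Jacobian, and
the variation of `ξ` (using `δ ≤ √δ`). The factor `4` of `B` bounds the `L²` norm of `ξ`. -/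
lemma enorm_integral_sub_le (hb : Measurable b) (hM : ∀ z, |b z| ≤ M) (hξ : Measurable ξ)
    (hsupp : ∀ z, z ∉ disk → ξ z = 0)
    (h2 : ∫⁻ z, ‖ξ z‖ₑ ^ (2 : ℝ) ≤ ENNReal.ofReal (4 ^ 2)) (hδ : 0 < δ) (hδ1 : δ ≤ 1)
    (hB : 0 ≤ B) {s : ℝ} (hs : 0 ≤ s) (hsδ : s ≤ δ)
    (hξs : ∫⁻ w in annulus δ, ‖ξ (pushOut s w) - ξ w‖ₑ ^ (2 : ℝ) ≤ ENNReal.ofReal ((8 * δ) ^ 2))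
    (hbs : ∫⁻ w in annulus δ, ‖b (pushOut s w) - b w‖ₑ ^ (2 : ℝ) ≤ ENNReal.ofReal (B ^ 2)) :
    ‖(∫ x in disk, b (flow (-δ⁻¹) x) * ξ x) -
        ∫ w in annulus δ, b (spin (s * δ⁻¹) (flow (-δ⁻¹) w)) * ξ w‖ₑ ≤
      ENNReal.ofReal (44 * M * √δ + 4 * B) := by
  have hM0 : 0 ≤ M := (abs_nonneg _).trans (hM 0)
  have hsq : 0 < √δ := Real.sqrt_pos.2 hδ
  have hsq1 : √δ ≤ 1 := Real.sqrt_le_one.2 hδ1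
  have hmsq : √δ * √δ = δ := Real.mul_self_sqrt hδ.le
  have hF := measurable_flow (-δ⁻¹)
  have hR := measurable_spin (s * δ⁻¹)
  have hP := measurable_pushOut s
  have hL1 := lintegral_enorm_le_of_support hξ hsupp h2
  have hA := measurableSet_annulus δ
  have hS := measurableSet_shiftedAnnulus δ s
  have hSd : shiftedAnnulus δ s ⊆ disk := by
    rintro z ⟨-, hz⟩
    simp only [disk, mem_ball_zero_iff]
    linarith
  have hξi : Integrable ξ :=
    ⟨hξ.aestronglyMeasurable, hL1.trans_lt ENNReal.ofReal_lt_top⟩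
  have hfi : Integrable fun x => b (flow (-δ⁻¹) x) * ξ x :=
    hξi.bdd_mul (c := M) (Measurable.aestronglyMeasurable (by fun_prop)) (ae_of_all _ fun x => hM _)
  have hni : Integrable fun w => b (spin (s * δ⁻¹) (flow (-δ⁻¹) w)) * ξ w :=
    hξi.bdd_mul (c := M) (Measurable.aestronglyMeasurable (by fun_prop)) (ae_of_all _ fun x => hM _)
  have hPL1 : ∫⁻ w in annulus δ, ‖ξ (pushOut s w)‖ₑ ≤ ENNReal.ofReal 8 :=
    (setLIntegral_le_lintegral _ _).trans
      ((lintegral_comp_pushOut_le hs hξ.enorm).trans hL1)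
  have hPi : IntegrableOn (fun w => (1 + s / ‖w‖) *
      (b (flow (-δ⁻¹) (pushOut s w)) * ξ (pushOut s w))) (annulus δ) := by
    have h1 : IntegrableOn (fun w => ξ (pushOut s w)) (annulus δ) :=
      ⟨(hξ.comp hP).aestronglyMeasurable, hPL1.trans_lt ENNReal.ofReal_lt_top⟩
    simp only [← mul_assoc]
    refine h1.bdd_mul (c := 2 * M) (Measurable.aestronglyMeasurable (by fun_prop)) ?_
    filter_upwards [ae_restrict_mem hA] with w hw
    have hwn : 0 < ‖w‖ := hsq.trans hw.1
    have hsw : s / ‖w‖ ≤ 1 := by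
      rw [div_le_iff₀ hwn]
      nlinarith [hw.1]
    rw [norm_mul, Real.norm_of_nonneg (by positivity)]
    exact mul_le_mul (by linarith) (hM _) (abs_nonneg _) zero_le_two
  have hsplit : (∫ x in disk, b (flow (-δ⁻¹) x) * ξ x) -
      ∫ w in annulus δ, b (spin (s * δ⁻¹) (flow (-δ⁻¹) w)) * ξ w =
      (∫ x in disk \ shiftedAnnulus δ s, b (flow (-δ⁻¹) x) * ξ x) +
      ∫ w in annulus δ, ((1 + s / ‖w‖) * (b (flow (-δ⁻¹) (pushOut s w)) * ξ (pushOut s w)) -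
        b (spin (s * δ⁻¹) (flow (-δ⁻¹) w)) * ξ w) := by
    rw [integral_sub hPi hni.integrableOn,
      ← integral_shiftedAnnulus hs (F := fun x => b (flow (-δ⁻¹) x) * ξ x) (by fun_prop),
      setIntegral_sdiff hS hfi.integrableOn hSd]
    ring
  have hout : ‖∫ x in disk \ shiftedAnnulus δ s, b (flow (-δ⁻¹) x) * ξ x‖ₑ ≤
      ENNReal.ofReal (M * (5 * √δ * 4)) := by
    refine (enorm_integral_le_lintegral_enorm _).trans ?_
    calc _ ≤ ∫⁻ x in disk \ shiftedAnnulus δ s, ENNReal.ofReal M * ‖ξ x‖ₑ := by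
          refine lintegral_mono fun x => ?_
          rw [enorm_mul]
          gcongr
          rw [← ofReal_norm]
          exact ENNReal.ofReal_le_ofReal (hM _)
      _ ≤ _ := by
          rw [lintegral_const_mul _ hξ.enorm, ENNReal.ofReal_mul hM0]
          gcongr
          refine lintegral_le_of_sq_le (by fun_prop) (by positivity) (by norm_num) ?_
            ((setLIntegral_le_lintegral _ _).trans h2)
          rw [Measure.restrict_apply_univ]
          exact volume_disk_diff_shiftedAnnulus_le hδ hδ1 hs hsδ
  -- Rotations and the flow preserve both the annulus and the measure, so the bound `hbs` survives
  -- the composition.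
  have hrot : ∫⁻ w in annulus δ, ‖b (pushOut s (spin (s * δ⁻¹) (flow (-δ⁻¹) w))) -
      b (spin (s * δ⁻¹) (flow (-δ⁻¹) w))‖ₑ ^ (2 : ℝ) ≤ ENNReal.ofReal (B ^ 2) := by
    have hmp := ((measurePreserving_spin (s * δ⁻¹)).comp
      (measurePreserving_flow (-δ⁻¹))).restrict_preimage hA
    have hpre : (spin (s * δ⁻¹) ∘ flow (-δ⁻¹)) ⁻¹' annulus δ = annulus δ :=
      ext fun z => by
        simp only [mem_preimage, Function.comp, spin, flow, twist_mem_annulus]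
    rw [hpre] at hmp
    have := hmp.lintegral_comp (f := fun w => ‖b (pushOut s w) - b w‖ₑ ^ (2 : ℝ)) (by fun_prop)
    exact this.le.trans hbs
  have hin : ‖∫ w in annulus δ, ((1 + s / ‖w‖) * (b (flow (-δ⁻¹) (pushOut s w)) *
      ξ (pushOut s w)) - b (spin (s * δ⁻¹) (flow (-δ⁻¹) w)) * ξ w)‖ₑ ≤
      ENNReal.ofReal (M * √δ * 8 + M * (2 * (8 * δ)) + B * 4) := by
    refine (enorm_integral_le_lintegral_enorm _).trans ?_
    refine (setLIntegral_mono' hA fun w hw => enorm_mul_pushOut_sub_le hM hδ hs hsδ hw).trans ?_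
    rw [lintegral_add_left (by fun_prop), lintegral_add_left (by fun_prop),
      lintegral_const_mul _ (by fun_prop), lintegral_const_mul _ (by fun_prop),
      ENNReal.ofReal_add (by positivity) (by positivity),
      ENNReal.ofReal_add (by positivity) (by positivity),
      ENNReal.ofReal_mul (by positivity : 0 ≤ M * √δ),
      ENNReal.ofReal_mul (q := 2 * (8 * δ)) hM0]
    refine add_le_add (add_le_add (mul_le_mul_right hPL1 _) (mul_le_mul_right ?_ _)) ?_
    · refine lintegral_le_of_sq_le (by fun_prop) (by norm_num) (by positivity) ?_ hξs
      rw [Measure.restrict_apply_univ]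
      refine (measure_mono (annulus_subset_disk hδ.le)).trans ?_
      rw [volume_disk]
      exact ENNReal.ofReal_le_ofReal (by linarith [Real.pi_le_four])
    · exact lintegral_mul_le_of_sq_le (by fun_prop) (by fun_prop) hB (by norm_num) hrot
        ((setLIntegral_le_lintegral _ _).trans h2)
  rw [hsplit]
  refine (enorm_add_le _ _).trans ((add_le_add hout hin).trans ?_)
  rw [← ENNReal.ofReal_add (by positivity) (by positivity)]
  refine ENNReal.ofReal_le_ofReal ?_
  have : M * δ ≤ M * √δ := by gcongr; nlinarith
  nlinarith

/-- The pairing of the transported density with a function is small if both change little under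
radial shifts of size at most the inverse time. -/
theorem enorm_integral_flow_mul_le (hb : Measurable b) (hM : ∀ z, |b z| ≤ M) (hbal : IsBalanced b)
    (hξ : Measurable ξ) (hsupp : ∀ z, z ∉ disk → ξ z = 0)
    (h2 : ∫⁻ z, ‖ξ z‖ₑ ^ (2 : ℝ) ≤ ENNReal.ofReal (4 ^ 2)) (hδ : 0 < δ) (hδ1 : δ ≤ 1)
    (hB : 0 ≤ B)
    (hξs : ∀ s, 0 ≤ s → s ≤ δ → ∫⁻ w in annulus δ, ‖ξ (pushOut s w) - ξ w‖ₑ ^ (2 : ℝ) ≤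
      ENNReal.ofReal ((8 * δ) ^ 2))
    (hbs : ∀ s, 0 ≤ s → s ≤ δ → ∫⁻ w in annulus δ, ‖b (pushOut s w) - b w‖ₑ ^ (2 : ℝ) ≤
      ENNReal.ofReal (B ^ 2)) :
    ‖∫ x in disk, b (flow (-δ⁻¹) x) * ξ x‖ₑ ≤ ENNReal.ofReal (44 * M * √δ + 4 * B) := by
  have hA := measurableSet_annulus δ
  have hξi : Integrable ξ := ⟨hξ.aestronglyMeasurable,
    (lintegral_enorm_le_of_support hξ hsupp h2).trans_lt ENNReal.ofReal_lt_top⟩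
  set J := ∫ x in disk, b (flow (-δ⁻¹) x) * ξ x with hJ
  set ζ : ℂ → ℝ := (annulus δ).indicator ξ with hζ
  have hζi : Integrable ζ := hξi.indicator hA
  have hN : ∀ a : ℝ, ∫ w, b (spin a (flow (-δ⁻¹) w)) * ζ w =
      ∫ w in annulus δ, b (spin a (flow (-δ⁻¹) w)) * ξ w := by
    intro a
    rw [← integral_indicator hA]
    refine integral_congr_ae (ae_of_all _ fun w => ?_)
    by_cases hw : w ∈ annulus δ <;> simp [hζ, hw]
  have hzero := hbal.integral_eq_zero hb hM hζi (-δ⁻¹)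
  have hNi := (integrable_spin_mul hb hM hζi (-δ⁻¹)).integral_prod_left
  -- `J` does not depend on `a`, and the subtracted pairing has mean zero in `a`.
  have hJeq : J = ∫ a in Ioc (0 : ℝ) 1, (J - ∫ w, b (spin a (flow (-δ⁻¹) w)) * ζ w) := by
    rw [integral_sub (integrable_const _) hNi, hzero]
    simp
  rw [hJeq]
  refine (enorm_integral_le_lintegral_enorm _).trans ?_
  calc _ ≤ ∫⁻ a in Ioc (0 : ℝ) 1, ENNReal.ofReal (44 * M * √δ + 4 * B) := by
        refine setLIntegral_mono' measurableSet_Ioc fun a ha => ?_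
        -- At time `δ⁻¹` the shift `a * δ` amounts to `a` full turns.
        have hs : 0 ≤ a * δ := mul_nonneg ha.1.le hδ.le
        have hsδ : a * δ ≤ δ := mul_le_of_le_one_left hδ.le ha.2
        have := enorm_integral_sub_le hb hM hξ hsupp h2 hδ hδ1 hB hs hsδ (hξs _ hs hsδ)
          (hbs _ hs hsδ)
        rw [mul_assoc, mul_inv_cancel₀ hδ.ne', mul_one] at this
        rw [hN]
        exact this
    _ = _ := by simp

end mainEstimate

/-! ### From the datum to the negative Sobolev norm. -/

lemma isFiniteMeasure_disk : IsFiniteMeasure (volume.restrict disk) := ⟨by simp [volume_disk]⟩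

lemma ae_abs_le_linftyNorm {ρ₀ : ℂ → ℝ} (hd : IsDatum ρ₀) :
    ∀ᵐ x ∂volume.restrict disk, |ρ₀ x| ≤ (linftyNorm ρ₀).toReal := by
  have hfin : linftyNorm ρ₀ < ⊤ := (hd.memLp.restrict disk).2
  filter_upwards [enorm_ae_le_eLpNormEssSup ρ₀ (volume.restrict disk)] with x hx
  rw [← eLpNorm_exponent_top] at hx
  have := ENNReal.toReal_mono hfin.ne hx
  simpa using this

lemma integral_spin_eq_circleAverage (f : ℂ → ℝ) (z : ℂ) :
    ∫ a in (0 : ℝ)..1, f (spin a z) = Real.circleAverage f 0 ‖z‖ := by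
  have h1 : ∀ a : ℝ, f (spin a z) =
      (fun θ => f (circleMap 0 ‖z‖ θ)) (z.arg + 2 * Real.pi * a) := by
    intro a
    simp only [spin, twist, circleMap, zero_add]
    push_cast
    rw [add_mul, Complex.exp_add, ← mul_assoc, Complex.norm_mul_exp_arg_mul_I]
  have hper : Function.Periodic (fun θ => f (circleMap 0 ‖z‖ θ)) (2 * Real.pi) := by
    intro θ
    simp only
    rw [periodic_circleMap]
  simp_rw [h1]
  rw [intervalIntegral.integral_comp_add_mul (fun θ => f (circleMap 0 ‖z‖ θ))
    Real.two_pi_pos.ne', mul_zero, add_zero, mul_one, hper.intervalIntegral_add_eq z.arg 0,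
    zero_add, Real.circleAverage_def]

/-- A bounded, measurable and balanced representative of the datum on the disk. -/
lemma IsDatum.exists_representative {ρ₀ : ℂ → ℝ} (hd : IsDatum ρ₀) :
    ∃ b : ℂ → ℝ, Measurable b ∧ (∀ z, |b z| ≤ (linftyNorm ρ₀).toReal) ∧ IsBalanced b ∧
      ∀ᵐ x ∂volume.restrict disk, ρ₀ x = b x := by
  obtain ⟨b₀, hb₀, hae⟩ := hd.memLp.aestronglyMeasurable.aemeasurable
  set m := (linftyNorm ρ₀).toReal with hm
  -- Truncation makes the bound hold at every point.
  set S : Set ℂ := disk ∩ {z | |b₀ z| ≤ m} with hS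
  have hSm : MeasurableSet S :=
    measurableSet_disk.inter (measurableSet_le hb₀.abs measurable_const)
  have heq : ∀ᵐ x ∂volume.restrict disk, ρ₀ x = S.indicator b₀ x := by
    filter_upwards [ae_restrict_of_ae hae, ae_abs_le_linftyNorm hd,
      ae_restrict_mem measurableSet_disk] with x h1 h2 h3
    rw [indicator_of_mem (show x ∈ S from ⟨h3, by rw [mem_ofPred_eq, ← h1]; exact h2⟩), h1]
  refine ⟨S.indicator b₀, hb₀.indicator hSm, fun z => ?_, ?_, heq⟩
  · by_cases hz : z ∈ S
    · rw [indicator_of_mem hz]; exact hz.2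
    · rw [indicator_of_notMem hz, abs_zero]; exact ENNReal.toReal_nonneg
  · rw [ae_restrict_iff' measurableSet_disk] at heq
    obtain ⟨N, hN, hNm, hN0⟩ := exists_measurable_superset_of_null (ae_iff.1 heq)
    -- Fubini: for almost every `z`, the circle through `z` meets the exceptional set in a null set
    -- of angles, so the circle averages of `ρ₀` pass to the representative.
    have hslice : ∀ᵐ z : ℂ, ∀ᵐ a : ℝ, spin a z ∉ N := by
      rw [← Measure.ae_ae_comm (p := fun (a : ℝ) (z : ℂ) => spin a z ∉ N)]
      · refine ae_of_all _ fun a => ?_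
        exact (measurePreserving_spin a).quasiMeasurePreserving.ae
          (measure_eq_zero_iff_ae_notMem.1 hN0)
      · exact (measurable_uncurry_spin hNm).compl
    filter_upwards [hslice, ae_norm_of_ae hd.circle] with z hz hcirc
    by_cases hzd : z ∈ disk
    · refine Eq.trans ?_ ((integral_spin_eq_circleAverage ρ₀ z).trans hcirc)
      refine intervalIntegral.integral_congr_ae ?_
      filter_upwards [hz] with a ha _
      have hsd : spin a z ∈ disk := twist_mem_disk.2 hzd
      by_contra hne
      exact ha (hN fun h => hne (h hsd).symm)
    · have : ∀ a, S.indicator b₀ (spin a z) = 0 := fun a =>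
        indicator_of_notMem (fun h => hzd (twist_mem_disk.1 h.1)) _
      simp [this]

lemma osc_congr {u v : ℂ → ℝ} (h : ∀ᵐ x ∂volume.restrict disk, u x = v x) (p R : ℝ) :
    osc p u R = osc p v R := by
  rw [ae_restrict_iff' measurableSet_disk] at h
  unfold osc
  refine lintegral_congr_ae ?_
  filter_upwards [h] with x hx
  refine lintegral_congr_ae ?_
  filter_upwards [h] with y hy
  by_cases hxy : (x, y) ∈ closePairs R
  · simp [oscIntegrand, hxy, hx hxy.1, hy hxy.2.1]
  · simp [oscIntegrand, hxy]

lemma HasWeakGradientOn.congr {u v : ℂ → ℝ} {g : ℂ → ℂ} (hw : HasWeakGradientOn disk u g)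
    (h : ∀ᵐ x ∂volume.restrict disk, u x = v x) (hv : IntegrableOn v disk) :
    HasWeakGradientOn disk v g := by
  refine ⟨hv.locallyIntegrableOn, hw.2.1, fun φ h1 h2 h3 e => ?_⟩
  rw [← hw.2.2 φ h1 h2 h3 e]
  refine integral_congr_ae ?_
  filter_upwards [h] with x hx
  rw [hx]

/-- The volume of the ball cancels in `lintegral_pushOut_sub_le`, whose factor `2 ^ 2` doubles `X`.
-/
lemma lintegral_annulus_le_of_osc_le {u : ℂ → ℝ} (hu : Measurable u) {δ X s : ℝ} (hδ : 0 < δ)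
    (hX : osc 2 u (2 * δ) ≤ volume (Metric.ball (0 : ℂ) δ) * ENNReal.ofReal (X ^ 2))
    (hs : 0 ≤ s) (hsδ : s ≤ δ) :
    ∫⁻ w in annulus δ, ‖u (pushOut s w) - u w‖ₑ ^ (2 : ℝ) ≤ ENNReal.ofReal ((2 * X) ^ 2) := by
  have hv0 : volume (Metric.ball (0 : ℂ) δ) ≠ 0 := (Metric.measure_ball_pos _ _ hδ).ne'
  have hv1 : volume (Metric.ball (0 : ℂ) δ) ≠ ⊤ := measure_ball_lt_top.ne
  have h := lintegral_pushOut_sub_le hu one_le_two hs hsδ (measurableSet_annulus δ)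
    (fun x hx => hx.2)
  have h2 : (2 : ℝ≥0∞) ^ (2 : ℝ) = ENNReal.ofReal 4 := by norm_num
  have h3 := h.trans (mul_le_mul_right hX _)
  rw [mul_left_comm, ENNReal.mul_le_mul_iff_right hv0 hv1, h2,
    ← ENNReal.ofReal_mul (by norm_num)] at h3
  refine h3.trans (le_of_eq ?_)
  congr 1
  ring

lemma volume_ball_two_mul (δ : ℝ) :
    volume (Metric.ball (0 : ℂ) (2 * δ)) = 4 * volume (Metric.ball (0 : ℂ) δ) := by
  rw [Complex.volume_ball, Complex.volume_ball, ENNReal.ofReal_mul zero_le_two, mul_pow]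
  norm_num
  ring

/-- The mixing estimate in terms of the mean oscillation of the datum at the scale `δ`, at the
time `δ⁻¹`. -/
theorem hDotNegOneNorm_le {ρ₀ : ℂ → ℝ} (hd : IsDatum ρ₀) {ρ : ℝ → ℂ → ℝ}
    (hρ : IsWeakSolution ρ₀ ρ) {δ X : ℝ} (hδ : 0 < δ) (hδ1 : δ ≤ 1) (hX0 : 0 ≤ X)
    (hX : osc 2 ρ₀ (2 * δ) ≤ volume (Metric.ball (0 : ℂ) δ) * ENNReal.ofReal (X ^ 2)) :
    hDotNegOneNorm (ρ δ⁻¹) ≤ ENNReal.ofReal (44 * (linftyNorm ρ₀).toReal * √δ + 8 * X) := by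
  have hfinm := isFiniteMeasure_disk
  obtain ⟨b, hb, hM, hbal, hae⟩ := hd.exists_representative
  set m := (linftyNorm ρ₀).toReal with hm
  have hρ₀i : IntegrableOn ρ₀ disk :=
    ((hd.memLp.restrict disk).mono_exponent le_top).integrable le_rfl
  have hflow : ∀ᵐ x ∂volume.restrict disk, ρ δ⁻¹ x = b (flow (-δ⁻¹) x) := by
    filter_upwards [weakSolution_ae_eq hρ₀i hρ (inv_nonneg.2 hδ.le),
      (measurePreserving_flow_disk (-δ⁻¹)).quasiMeasurePreserving.ae hae] with x h1 h2
    rw [h1, h2]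
  refine iSup_le fun ξ => iSup_le fun g => iSup_le fun hξ => iSup_le fun hw => iSup_le fun hg => ?_
  obtain ⟨ξ₀, hξ₀m, hξ₀⟩ := hξ.aestronglyMeasurable.aemeasurable
  have hξ₀i : IntegrableOn ξ₀ disk := (hξ.integrable one_le_two).congr hξ₀
  have hw₀ := hw.congr hξ₀ hξ₀i
  have hgm : MemLp g 2 (volume.restrict disk) :=
    ⟨hw.2.1.aestronglyMeasurable, hg.trans_lt ENNReal.one_lt_top⟩
  have hgi : IntegrableOn g disk := hgm.integrable one_le_two
  have hgE : ∫⁻ x in disk, ‖g x‖ₑ ^ (2 : ℝ) ≤ 1 := by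
    rw [eLpNorm_eq_lintegral_rpow_enorm_toReal two_ne_zero ENNReal.ofNat_ne_top] at hg
    simp only [ENNReal.toReal_ofNat] at hg
    have := ENNReal.rpow_le_rpow hg (zero_le_two (α := ℝ))
    rwa [← ENNReal.rpow_mul, one_div, inv_mul_cancel₀ two_ne_zero, ENNReal.rpow_one,
      ENNReal.one_rpow] at this
  obtain ⟨c, hc⟩ := exists_lintegral_sub_const_le hξ₀m hw₀ hξ₀i hgi
  -- Subtracting the Poincaré constant yields the `L²` bound `4`. It leaves the pairing unchanged,
  -- since the transported datum has mean zero, and it cancels in radial differences.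
  set ξ₁ : ℂ → ℝ := disk.indicator fun x => ξ₀ x - c with hξ₁
  have hξ₁m : Measurable ξ₁ := (hξ₀m.sub_const c).indicator measurableSet_disk
  have h2 : ∫⁻ z, ‖ξ₁ z‖ₑ ^ (2 : ℝ) ≤ ENNReal.ofReal (4 ^ 2) := by
    have e : ∫⁻ z, ‖ξ₁ z‖ₑ ^ (2 : ℝ) = ∫⁻ x in disk, ‖ξ₀ x - c‖ₑ ^ (2 : ℝ) := by
      rw [← lintegral_indicator measurableSet_disk]
      refine lintegral_congr fun z => ?_
      by_cases hz : z ∈ disk <;> simp [hξ₁, hz]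
    rw [e]
    refine hc.trans ((mul_le_mul_right hgE 16).trans (le_of_eq ?_))
    norm_num
  have hoscξ : osc 2 ξ₀ (2 * δ) ≤
      volume (Metric.ball (0 : ℂ) δ) * ENNReal.ofReal ((4 * δ) ^ 2) := by
    refine (osc_le_of_hasWeakGradientOn hξ₀m hw₀ hξ₀i hgi one_le_two (2 * δ)).trans ?_
    rw [volume_ball_two_mul, mul_comm 4, mul_assoc]
    refine mul_le_mul_right ?_ _
    refine (mul_le_mul_right (mul_le_mul_right hgE _) _).trans (le_of_eq ?_)
    rw [mul_one, ENNReal.rpow_two, ← ENNReal.ofReal_pow (by positivity),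
      show (4 : ℝ≥0∞) = ENNReal.ofReal 4 by norm_num, ← ENNReal.ofReal_mul (by norm_num)]
    congr 1
    ring
  have hξs : ∀ s, 0 ≤ s → s ≤ δ → ∫⁻ w in annulus δ, ‖ξ₁ (pushOut s w) - ξ₁ w‖ₑ ^ (2 : ℝ) ≤
      ENNReal.ofReal ((8 * δ) ^ 2) := by
    intro s hs hsδ
    have h := lintegral_annulus_le_of_osc_le hξ₀m hδ hoscξ hs hsδ
    rw [show 2 * (4 * δ) = 8 * δ by ring] at h
    refine le_trans (le_of_eq ?_) h
    refine setLIntegral_congr_fun (measurableSet_annulus δ) fun w hw => ?_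
    have hwd : w ∈ disk := annulus_subset_disk hδ.le hw
    have hσd : pushOut s w ∈ disk := by
      have := (pushOut_mem_shiftedAnnulus hs).2 hw
      simp only [disk, mem_ball_zero_iff]
      linarith [this.2]
    simp [hξ₁, hwd, hσd]
  have hbs : ∀ s, 0 ≤ s → s ≤ δ → ∫⁻ w in annulus δ, ‖b (pushOut s w) - b w‖ₑ ^ (2 : ℝ) ≤
      ENNReal.ofReal ((2 * X) ^ 2) := fun s hs hsδ =>
    lintegral_annulus_le_of_osc_le hb hδ (by rwa [← osc_congr hae]) hs hsδ
  have key := enorm_integral_flow_mul_le hb hM hbal hξ₁m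
    (fun z hz => indicator_of_notMem hz _) h2 hδ hδ1 (by positivity : 0 ≤ 2 * X) hξs hbs
  have hbf : AEStronglyMeasurable (fun x => b (flow (-δ⁻¹) x)) (volume.restrict disk) :=
    (hb.comp (measurable_flow _)).aestronglyMeasurable
  have hint : ∫ x in disk, ρ δ⁻¹ x * ξ x = ∫ x in disk, b (flow (-δ⁻¹) x) * ξ₁ x := by
    have e1 : ∫ x in disk, ρ δ⁻¹ x * ξ x = ∫ x in disk, b (flow (-δ⁻¹) x) * ξ₀ x := by
      refine integral_congr_ae ?_
      filter_upwards [hflow, hξ₀] with x h1 h2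
      rw [h1, h2]
    have e2 : ∫ x in disk, b (flow (-δ⁻¹) x) * ξ₁ x =
        ∫ x in disk, (b (flow (-δ⁻¹) x) * ξ₀ x - b (flow (-δ⁻¹) x) * c) := by
      refine setIntegral_congr_fun measurableSet_disk fun x hx => ?_
      simp [hξ₁, hx, mul_sub]
    have i1 : Integrable (fun x => b (flow (-δ⁻¹) x) * ξ₀ x) (volume.restrict disk) :=
      hξ₀i.bdd_mul (c := m) hbf (ae_of_all _ fun x => hM _)
    have i2 : Integrable (fun x => b (flow (-δ⁻¹) x) * c) (volume.restrict disk) :=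
      (integrable_const c).bdd_mul (c := m) hbf (ae_of_all _ fun x => hM _)
    rw [e1, e2, integral_sub i1 i2, integral_mul_const, hbal.setIntegral_disk hb hM, zero_mul,
      sub_zero]
  rw [hint]
  refine le_trans ?_ (key.trans (ENNReal.ofReal_le_ofReal (le_of_eq (by ring))))
  rw [← ofReal_norm]
  exact ENNReal.ofReal_le_ofReal (le_abs_self _)

/-! ### Mean oscillation of Hölder and Sobolev data. -/

/-- One factor of the squared difference is bounded by twice the supremum norm. -/
lemma osc_two_le_osc_one {ρ₀ : ℂ → ℝ} (hd : IsDatum ρ₀) (R : ℝ) :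
    osc 2 ρ₀ R ≤ ENNReal.ofReal (2 * (linftyNorm ρ₀).toReal) * osc 1 ρ₀ R := by
  have h := ae_abs_le_linftyNorm hd
  rw [ae_restrict_iff' measurableSet_disk] at h
  unfold osc
  rw [← lintegral_const_mul' _ _ ENNReal.ofReal_ne_top]
  refine lintegral_mono_ae ?_
  filter_upwards [h] with x hx
  rw [← lintegral_const_mul' _ _ ENNReal.ofReal_ne_top]
  refine lintegral_mono_ae ?_
  filter_upwards [h] with y hy
  by_cases hxy : (x, y) ∈ closePairs R
  · simp only [oscIntegrand, hxy, indicator_of_mem, ENNReal.rpow_one, ENNReal.rpow_two, sq]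
    gcongr
    rw [← ofReal_norm]
    refine ENNReal.ofReal_le_ofReal ((abs_sub _ _).trans ?_)
    linarith [hx hxy.1, hy hxy.2.1]
  · simp [oscIntegrand, hxy]

lemma volume_ball_le_ofReal (δ : ℝ) (hδ : 0 ≤ δ) :
    ENNReal.ofReal (δ ^ 2) ≤ volume (Metric.ball (0 : ℂ) δ) := by
  have hπ : ((NNReal.pi : NNReal) : ℝ≥0∞) = ENNReal.ofReal Real.pi := by
    rw [← volume_disk, disk, Complex.volume_ball]; simp
  rw [Complex.volume_ball, hπ, ← ENNReal.ofReal_pow hδ, ← ENNReal.ofReal_mul (by positivity)]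
  refine ENNReal.ofReal_le_ofReal ?_
  nlinarith [Real.pi_gt_three, sq_nonneg δ]

/-- Differences at distance below `2δ` are at most `2Hδ^α` as `2^α ≤ 2`. The pairs have measure at
most `16` times the ball of radius `δ`, and `4 * 16 = 8 ^ 2`. -/
lemma osc_two_le_of_holderNorm {α : ℝ} (hα : 0 < α) (hα1 : α ≤ 1) {ρ₀ : ℂ → ℝ}
    (hH : holderNorm α ρ₀ < ⊤) {δ : ℝ} (hδ : 0 < δ) :
    osc 2 ρ₀ (2 * δ) ≤ volume (Metric.ball (0 : ℂ) δ) *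
      ENNReal.ofReal ((8 * (holderNorm α ρ₀).toReal * δ ^ α) ^ 2) := by
  set H := (holderNorm α ρ₀).toReal with hHdef
  have hH0 : 0 ≤ H := ENNReal.toReal_nonneg
  have hpt : ∀ x ∈ disk, ∀ y ∈ disk, ‖y - x‖ < 2 * δ → |ρ₀ x - ρ₀ y| ≤ H * (2 * δ ^ α) := by
    intro x hx y hy hxy
    by_cases hne : x = y
    · simp only [hne, sub_self, abs_zero]; positivity
    have h1 : ENNReal.ofReal (|ρ₀ x - ρ₀ y| / ‖x - y‖ ^ α) ≤ holderNorm α ρ₀ :=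
      le_trans (le_iSup₂_of_le x hx (le_iSup₂_of_le y hy
        (le_iSup (fun _ : x ≠ y => ENNReal.ofReal (|ρ₀ x - ρ₀ y| / ‖x - y‖ ^ α)) hne)))
        le_add_self
    have h2 := (ENNReal.ofReal_le_iff_le_toReal hH.ne).1 h1
    have hpos : 0 < ‖x - y‖ := norm_pos_iff.2 (sub_ne_zero.2 hne)
    rw [div_le_iff₀ (Real.rpow_pos_of_pos hpos _)] at h2
    refine h2.trans (mul_le_mul_of_nonneg_left ?_ hH0)
    calc ‖x - y‖ ^ α ≤ (2 * δ) ^ α := by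
          gcongr
          rw [norm_sub_rev]; exact hxy.le
      _ = 2 ^ α * δ ^ α := Real.mul_rpow zero_le_two hδ.le
      _ ≤ 2 * δ ^ α := by
          gcongr
          calc (2 : ℝ) ^ α ≤ 2 ^ (1 : ℝ) := Real.rpow_le_rpow_of_exponent_le one_le_two hα1
            _ = 2 := Real.rpow_one 2
  have hin : ∀ x, ∫⁻ y, oscIntegrand 2 ρ₀ (2 * δ) (x, y) ≤ disk.indicator (fun _ =>
      ENNReal.ofReal ((H * (2 * δ ^ α)) ^ 2) * (4 * volume (Metric.ball (0 : ℂ) δ))) x := by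
    intro x
    by_cases hx : x ∈ disk
    swap
    · simp [oscIntegrand, closePairs, hx]
    rw [indicator_of_mem hx, ← volume_ball_two_mul,
      show volume (Metric.ball (0 : ℂ) (2 * δ)) = volume (Metric.ball x (2 * δ)) by
        rw [Complex.volume_ball, Complex.volume_ball], ← setLIntegral_const,
      ← lintegral_indicator Metric.isOpen_ball.measurableSet]
    refine lintegral_mono fun y => ?_
    by_cases hxy : (x, y) ∈ closePairs (2 * δ)
    · have hy : y ∈ Metric.ball x (2 * δ) := by
        rw [Metric.mem_ball, dist_eq_norm]; exact hxy.2.2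
      simp only [oscIntegrand, hxy, indicator_of_mem, hy]
      rw [ENNReal.rpow_two, ← ofReal_norm, ← ENNReal.ofReal_pow (norm_nonneg _)]
      refine ENNReal.ofReal_le_ofReal ?_
      exact pow_le_pow_left₀ (norm_nonneg _) (hpt x hx y hxy.2.1 hxy.2.2) 2
    · simp [oscIntegrand, hxy]
  refine (lintegral_mono hin).trans ?_
  rw [lintegral_indicator measurableSet_disk, setLIntegral_const, volume_disk]
  have h4 : ENNReal.ofReal Real.pi ≤ ENNReal.ofReal 4 := ENNReal.ofReal_le_ofReal Real.pi_le_four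
  refine (mul_le_mul_right h4 _).trans (le_of_eq ?_)
  rw [show ENNReal.ofReal ((H * (2 * δ ^ α)) ^ 2) * (4 * volume (Metric.ball (0 : ℂ) δ)) *
    ENNReal.ofReal 4 = volume (Metric.ball (0 : ℂ) δ) *
      (ENNReal.ofReal ((H * (2 * δ ^ α)) ^ 2) * (4 * ENNReal.ofReal 4)) by ring,
    show (4 : ℝ≥0∞) * ENNReal.ofReal 4 = ENNReal.ofReal 16 by norm_num,
    ← ENNReal.ofReal_mul (by positivity)]
  congr 2
  ring

/-- For `α < 1` the Gagliardo kernel is at least `(2δ)^(-(2 + α))` on close pairs. For `α = 1` the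
translation estimate applies with `p = 1`. -/
lemma osc_one_le_of_sobolevSeminorm {α : ℝ} (hα : 0 < α) (hα1 : α ≤ 1) {ρ₀ : ℂ → ℝ}
    (hd : IsDatum ρ₀) {δ : ℝ} (hδ : 0 < δ) :
    osc 1 ρ₀ (2 * δ) ≤ volume (Metric.ball (0 : ℂ) δ) *
      (ENNReal.ofReal (8 * δ ^ α) * sobolevSeminorm α ρ₀) := by
  rcases hα1.lt_or_eq with hlt | rfl
  · have hpt : ∀ x y, oscIntegrand 1 ρ₀ (2 * δ) (x, y) ≤
        ENNReal.ofReal ((2 * δ) ^ (2 + α)) * disk.indicator (fun x => disk.indicator (fun y =>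
          ENNReal.ofReal (|ρ₀ x - ρ₀ y| / ‖x - y‖ ^ (2 + α))) y) x := by
      intro x y
      by_cases hxy : (x, y) ∈ closePairs (2 * δ)
      swap
      · simp [oscIntegrand, hxy]
      simp only [oscIntegrand, hxy, indicator_of_mem, hxy.1, hxy.2.1, ENNReal.rpow_one]
      by_cases hne : x = y
      · simp [hne]
      have hpos : 0 < ‖x - y‖ := norm_pos_iff.2 (sub_ne_zero.2 hne)
      rw [← ofReal_norm, ← ENNReal.ofReal_mul (by positivity)]
      refine ENNReal.ofReal_le_ofReal ?_
      rw [Real.norm_eq_abs, mul_div_assoc', le_div_iff₀ (Real.rpow_pos_of_pos hpos _), mul_comm]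
      gcongr
      rw [norm_sub_rev]
      exact hxy.2.2.le
    have hsum : osc 1 ρ₀ (2 * δ) ≤
        ENNReal.ofReal ((2 * δ) ^ (2 + α)) * sobolevSeminorm α ρ₀ := by
      rw [sobolevSeminorm, if_pos hlt, ← lintegral_indicator measurableSet_disk,
        ← lintegral_const_mul' _ _ ENNReal.ofReal_ne_top]
      refine lintegral_mono fun x => ?_
      refine (lintegral_mono (hpt x)).trans ?_
      rw [lintegral_const_mul' _ _ ENNReal.ofReal_ne_top]
      by_cases hx : x ∈ disk
      · simp [hx, lintegral_indicator measurableSet_disk]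
      · simp [hx]
    refine hsum.trans ?_
    rw [← mul_assoc]
    refine mul_le_mul_left ?_ _
    refine le_trans ?_ (mul_le_mul_left (volume_ball_le_ofReal δ hδ.le) _)
    rw [← ENNReal.ofReal_mul (by positivity)]
    refine ENNReal.ofReal_le_ofReal ?_
    rw [Real.rpow_add (by positivity), Real.rpow_two, Real.mul_rpow zero_le_two hδ.le]
    have : (2 : ℝ) ^ α ≤ 2 := by
      calc (2 : ℝ) ^ α ≤ 2 ^ (1 : ℝ) := Real.rpow_le_rpow_of_exponent_le one_le_two hα1
        _ = 2 := Real.rpow_one 2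
    have h0 : 0 ≤ δ ^ 2 * δ ^ α := by positivity
    nlinarith
  · obtain ⟨b, hb, hM, -, hae⟩ := hd.exists_representative
    have hfinm := isFiniteMeasure_disk
    have hρ₀i : IntegrableOn ρ₀ disk :=
      ((hd.memLp.restrict disk).mono_exponent le_top).integrable le_rfl
    have hbi : IntegrableOn b disk := hρ₀i.congr hae
    set c := volume (Metric.ball (0 : ℂ) δ) * ENNReal.ofReal (8 * δ ^ (1 : ℝ)) with hc
    have hc0 : c ≠ 0 := mul_ne_zero (Metric.measure_ball_pos _ _ hδ).ne' (by
      simp only [Real.rpow_one, ne_eq, ENNReal.ofReal_eq_zero, not_le]; positivity)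
    have hcT : c ≠ ⊤ := ENNReal.mul_ne_top measure_ball_lt_top.ne ENNReal.ofReal_ne_top
    -- Dividing by `c`, which is neither zero nor infinite, allows the bound to be checked for each
    -- weak gradient in the infimum.
    rw [← mul_assoc, ← hc, mul_comm c, ← ENNReal.div_le_iff hc0 hcT, sobolevSeminorm,
      if_neg (lt_irrefl _)]
    refine le_iInf fun g => le_iInf fun hw => ?_
    rw [ENNReal.div_le_iff hc0 hcT]
    -- A weak gradient is only locally integrable a priori; if its norm is infinite the bound is
    -- trivial.
    by_cases hfin : ∫⁻ x in disk, ‖g x‖ₑ = ⊤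
    · rw [hfin, ENNReal.top_mul hc0]; exact le_top
    have hgi : IntegrableOn g disk :=
      ⟨hw.2.1.aestronglyMeasurable, lt_top_iff_ne_top.2 hfin⟩
    rw [osc_congr hae]
    refine (osc_le_of_hasWeakGradientOn hb (hw.congr hae hbi) hbi hgi le_rfl (2 * δ)).trans
      (le_of_eq ?_)
    simp only [ENNReal.rpow_one, Real.rpow_one, hc]
    rw [volume_ball_two_mul, show 8 * δ = 4 * (2 * δ) by ring, ENNReal.ofReal_mul (p := 4)
      (by norm_num), show ENNReal.ofReal 4 = 4 by norm_num]
    ring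

lemma osc_two_le_of_sobolevSeminorm {α : ℝ} (hα : 0 < α) (hα1 : α ≤ 1) {ρ₀ : ℂ → ℝ}
    (hd : IsDatum ρ₀) (hW : sobolevSeminorm α ρ₀ < ⊤) {δ : ℝ} (hδ : 0 < δ) :
    osc 2 ρ₀ (2 * δ) ≤ volume (Metric.ball (0 : ℂ) δ) * ENNReal.ofReal
      ((4 * √((linftyNorm ρ₀).toReal * (sobolevSeminorm α ρ₀).toReal) * δ ^ (α / 2)) ^ 2) := by
  set m := (linftyNorm ρ₀).toReal
  set W := (sobolevSeminorm α ρ₀).toReal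
  have hm0 : 0 ≤ m := ENNReal.toReal_nonneg
  have hW0 : 0 ≤ W := ENNReal.toReal_nonneg
  refine (osc_two_le_osc_one hd _).trans
    ((mul_le_mul_right (osc_one_le_of_sobolevSeminorm hα hα1 hd hδ) _).trans (le_of_eq ?_))
  rw [← ENNReal.ofReal_toReal hW.ne, ← ENNReal.ofReal_mul (by positivity), mul_left_comm,
    ← ENNReal.ofReal_mul (by positivity)]
  congr 2
  have h1 : (δ ^ (α / 2)) ^ 2 = δ ^ α := by
    rw [← Real.rpow_natCast, ← Real.rpow_mul hδ.le]
    norm_num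
  rw [mul_pow, mul_pow, Real.sq_sqrt (by positivity), h1]
  ring

/-! ### Decay rates. -/

lemma inv_rpow_le_rpow_neg {t x y : ℝ} (ht : 1 ≤ t) (hxy : x ≤ y) : (t⁻¹) ^ y ≤ t ^ (-x) := by
  rw [Real.inv_rpow (by linarith), ← Real.rpow_neg (by linarith)]
  exact Real.rpow_le_rpow_of_exponent_le ht (by linarith)

end RadialMixing

open RadialMixing in
theorem proposition1p7 :
    (∃ C₃ C₄ : ℝ → ℝ → ℝ → ℝ, (∀ a h m : ℝ, 0 < C₃ a h m ∧ 0 < C₄ a h m) ∧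
      ∀ α : ℝ, 0 < α → α ≤ 1 →
      ∀ ρ₀ : ℂ → ℝ, RadialMixing.IsDatum ρ₀ → RadialMixing.holderNorm α ρ₀ < ⊤ →
      ∀ ρ : ℝ → ℂ → ℝ, RadialMixing.IsWeakSolution ρ₀ ρ →
      ∀ t : ℝ,
        C₄ α (RadialMixing.holderNorm α ρ₀).toReal (RadialMixing.linftyNorm ρ₀).toReal ≤ t →
        RadialMixing.hDotNegOneNorm (ρ t) ≤ ENNReal.ofReal
          (C₃ α (RadialMixing.holderNorm α ρ₀).toReal (RadialMixing.linftyNorm ρ₀).toReal *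
            t ^ (-(α / (α + 1))))) ∧
    (∃ C₅ C₆ : ℝ → ℝ → ℝ → ℝ, (∀ a w m : ℝ, 0 < C₅ a w m ∧ 0 < C₆ a w m) ∧
      ∀ α : ℝ, 0 < α → α ≤ 1 →
      ∀ ρ₀ : ℂ → ℝ, RadialMixing.IsDatum ρ₀ → RadialMixing.sobolevSeminorm α ρ₀ < ⊤ →
      ∀ ρ : ℝ → ℂ → ℝ, RadialMixing.IsWeakSolution ρ₀ ρ →
      ∀ t : ℝ,
        C₆ α (RadialMixing.sobolevSeminorm α ρ₀).toReal
          (RadialMixing.linftyNorm ρ₀).toReal ≤ t →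
        RadialMixing.hDotNegOneNorm (ρ t) ≤ ENNReal.ofReal
          (C₅ α (RadialMixing.sobolevSeminorm α ρ₀).toReal
              (RadialMixing.linftyNorm ρ₀).toReal *
            t ^ (-(α / (α + 4))))) := by
  -- The coefficients are those of `hDotNegOneNorm_le`, with `8 * 8 = 64` and `8 * 4 = 32`. Absolute
  -- values and `+ 1` make them positive for all real arguments. The threshold `1` ensures `δ = t⁻¹
  -- ≤ 1`.
  refine ⟨⟨fun _ h m => 44 * |m| + 64 * |h| + 1, fun _ _ _ => 1,
    fun _ _ _ => ⟨by positivity, one_pos⟩, ?_⟩, ⟨fun _ w m => 44 * |m| + 32 * √(|m| * |w|) + 1,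
    fun _ _ _ => 1, fun _ _ _ => ⟨by positivity, one_pos⟩, ?_⟩⟩
  · intro α hα hα1 ρ₀ hd hH ρ hρ t ht
    have ht0 : 0 < t := by linarith
    have h := hDotNegOneNorm_le hd hρ (inv_pos.2 ht0) (inv_le_one_of_one_le₀ ht) (by positivity)
      (osc_two_le_of_holderNorm hα hα1 hH (inv_pos.2 ht0))
    rw [inv_inv] at h
    refine h.trans (ENNReal.ofReal_le_ofReal ?_)
    simp only at ht ⊢
    rw [abs_of_nonneg ENNReal.toReal_nonneg, abs_of_nonneg ENNReal.toReal_nonneg,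
      Real.sqrt_eq_rpow]
    have hm0 : 0 ≤ (linftyNorm ρ₀).toReal := ENNReal.toReal_nonneg
    have hH0 : 0 ≤ (holderNorm α ρ₀).toReal := ENNReal.toReal_nonneg
    -- Here `α ≤ 1` is needed: `α / (α + 1) ≤ 1 / 2`.
    have e1 : (t⁻¹) ^ (1 / (2 : ℝ)) ≤ t ^ (-(α / (α + 1))) := by
      refine inv_rpow_le_rpow_neg ht ?_
      rw [div_le_div_iff₀ (by linarith) (by norm_num)]; linarith
    have e2 : (t⁻¹) ^ α ≤ t ^ (-(α / (α + 1))) := by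
      refine inv_rpow_le_rpow_neg ht ?_
      exact div_le_self hα.le (by linarith)
    have e3 : 0 ≤ t ^ (-(α / (α + 1))) := by positivity
    have f1 := mul_le_mul_of_nonneg_left e1 hm0
    have f2 := mul_le_mul_of_nonneg_left e2 hH0
    linarith
  · intro α hα hα1 ρ₀ hd hW ρ hρ t ht
    have ht0 : 0 < t := by linarith
    have h := hDotNegOneNorm_le hd hρ (inv_pos.2 ht0) (inv_le_one_of_one_le₀ ht) (by positivity)
      (osc_two_le_of_sobolevSeminorm hα hα1 hd hW (inv_pos.2 ht0))
    rw [inv_inv] at h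
    refine h.trans (ENNReal.ofReal_le_ofReal ?_)
    simp only at ht ⊢
    rw [abs_of_nonneg ENNReal.toReal_nonneg, abs_of_nonneg ENNReal.toReal_nonneg,
      Real.sqrt_eq_rpow (t⁻¹)]
    have hm0 : 0 ≤ (linftyNorm ρ₀).toReal := ENNReal.toReal_nonneg
    have e1 : (t⁻¹) ^ (1 / (2 : ℝ)) ≤ t ^ (-(α / (α + 4))) := by
      refine inv_rpow_le_rpow_neg ht ?_
      rw [div_le_div_iff₀ (by linarith) (by norm_num)]; linarith
    have e2 : (t⁻¹) ^ (α / 2) ≤ t ^ (-(α / (α + 4))) := by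
      refine inv_rpow_le_rpow_neg ht ?_
      exact div_le_div_of_nonneg_left hα.le (by norm_num) (by linarith)
    have e3 : 0 ≤ t ^ (-(α / (α + 4))) := by positivity
    have f1 := mul_le_mul_of_nonneg_left e1 hm0
    have f2 := mul_le_mul_of_nonneg_left e2
      (Real.sqrt_nonneg ((linftyNorm ρ₀).toReal * (sobolevSeminorm α ρ₀).toReal))
    linarith
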